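/- **Setting.** On an open set $U$ of the space of events $(\zeta,u,v)\in\mathbb C\times\mathbb R\times\mathbb R$ consider a vacuum pp-wave metric $$ds^2=2\,d\zeta\,d\bar\zeta-2\,du\,dv-(f+\bar f)\,du^2,\qquad f=f(\zeta,u),$$ and let $(\delta,\delta^*,\Delta,D)$ be a smooth complex null tetrad on $U$ with dual coframe $\theta^1,\dots,\theta^4$, so that $ds^2=2\theta^1\theta^2-2\theta^3\theta^4$. Let $\omega_{ab}=g(e_a,\nabla e_b)$ be the Levi-Civita connection forms, $\Omega_{ab}$ the curvature forms, and define the spin coefficients $\alpha,\gamma$ as the $\theta^2$- and $\theta^3$-components of $-(\omega_{12}+\omega_{34})/2$, $\mu,\nu$ as the $\theta^1$- and $\theta^3$-components of $\omega_{23}$, and $\Psi_4$ as the $\theta^2\wedge\theta^3$-component of $\Omega_{23}$. The tetrad is normalized: $D$ is a positive multiple of $\partial_v$, $d\zeta(\delta)\neq0$, $\Psi_4=1$ and $\gamma=0$. A star denotes complex conjugation. Put $$A=\frac{\delta^*\alpha}{\alpha^2},\quad M=\alpha\mu,\quad \tilde X=\frac{\Delta\log M^*}{1-A^*},\quad \tilde\nu=\nu+\frac{\tilde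 X(\tilde X^*+2\mu-A^*\tilde X)}{\alpha^*},$$ $$\tilde\Upsilon=\Delta(\tilde\nu/\tilde X^*)-2\tilde\nu+\frac1\alpha-\frac{4i\tilde X\,\mathrm{Im}\tilde X}{\alpha^*}.$$ **Proposition.** Let $g=g(u)$ be a smooth complex-valued function, $k_0\ne0$, $k_1\neq0$ and $k$ real constants, and suppose that on $U$ the function $f$ has one of the following forms (the power being taken with a holomorphic branch of the logarithm): * $\mathrm{BP}_{13}$: $f=(k_0z)^{ik_1}u^{-2}+g\,u^{-2}z$, with $z=u^{-ik}\zeta$, $u>0$ and $kk_1\neq2$; * $\mathrm{CP}_{13}$: $f=(k_0z)^{ik_1}+g\,z$, with $z=e^{iu}\zeta$; * $\mathrm{BE}_{13}$: $f=\exp(k_0z)\,u^{-2}+g\,u^{-2}z$, with $z=u^{-ik}\zeta$, $u>0$ and $k\neq0$; * $\mathrm{CE}_{13}$: $f=\exp(k_0z)+g\,z$, with $z=e^{iu}\zeta$. Then the following are equivalent: (i) $d\alpha\wedge d\mu\wedge d\nu=0$ on $U$; (ii) $\tilde\Upsilon=0$ on $U$; (iii) $g'(u)=0$ for every value $u$ taken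 on $U$. If, instead, $f$ has the form $\exp(k_0z)+g\,z$ with $z=u^{-ik}\zeta$, $u>0$, $k\ne0$ (the other representation of the class $\mathrm{BE}_{13}$), then (i) and (ii) are equivalent. -/

import Mathlib

noncomputable section

namespace PPWave

open Complex

/-- The coordinate space of the events `(ζ, u, v)`, with `ζ` complex and `u`, `v` real. -/
abbrev Event : Type := ℂ × ℝ × ℝ

/-- A complex vector field, given by its components with respect to
`∂_ζ, ∂_ζ̄, ∂_u, ∂_v` (in this order). -/
abbrev CField : Type := Event → Fin 4 → ℂ

/-- The four coordinate derivatives `∂_ζ φ, ∂_ζ̄ φ, ∂_u φ, ∂_v φ` of a complex function, the first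
two being the Wirtinger derivatives. -/
def coordDeriv (φ : Event → ℂ) (p : Event) : Fin 4 → ℂ :=
  ![(fderiv ℝ φ p (1, 0, 0) - I * fderiv ℝ φ p (I, 0, 0)) / 2,
    (fderiv ℝ φ p (1, 0, 0) + I * fderiv ℝ φ p (I, 0, 0)) / 2,
    fderiv ℝ φ p (0, 1, 0),
    fderiv ℝ φ p (0, 0, 1)]

/-- The derivative `V φ` of a complex function along a complex vector field. -/
def along (V : CField) (φ : Event → ℂ) : Event → ℂ :=
  fun p => ∑ i, V p i * coordDeriv φ p i

/-- The Lie bracket `[V, W]`. -/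
def bracket (V W : CField) : CField :=
  fun p i => along V (fun q => W q i) p - along W (fun q => V q i) p

/-- The complex conjugate of a complex vector field; conjugation interchanges `∂_ζ` and `∂_ζ̄`. -/
def conjField (V : CField) : CField :=
  fun p => ![star (V p 1), star (V p 0), star (V p 2), star (V p 3)]

/-- The metric `2 dζ dζ̄ - 2 du dv - (f + f̄) du²`, as a matrix with respect to
`∂_ζ, ∂_ζ̄, ∂_u, ∂_v`. -/
def metric (f : ℂ → ℝ → ℂ) (p : Event) : Matrix (Fin 4) (Fin 4) ℂ :=
  !![0, 1, 0, 0;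
     1, 0, 0, 0;
     0, 0, -(f p.1 p.2.1 + star (f p.1 p.2.1)), -1;
     0, 0, -1, 0]

/-- The metric applied to two complex vector fields. -/
def ip (f : ℂ → ℝ → ℂ) (V W : CField) : Event → ℂ :=
  fun p => ∑ i, ∑ j, metric f p i j * V p i * W p j

/-- The Christoffel symbols of the first kind,
`Γ_{i,jk} = (∂_j g_{ik} + ∂_k g_{ij} - ∂_i g_{jk}) / 2`. -/
def christoffel (f : ℂ → ℝ → ℂ) (p : Event) (i j k : Fin 4) : ℂ :=
  (coordDeriv (fun q => metric f q i k) p j + coordDeriv (fun q => metric f q i j) p k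
    - coordDeriv (fun q => metric f q j k) p i) / 2

/-- `g(Z, ∇_X Y)` for the Levi-Civita connection `∇` of the metric. -/
def ipNabla (f : ℂ → ℝ → ℂ) (Z X Y : CField) : Event → ℂ :=
  fun p => (∑ i, ∑ j, metric f p i j * Z p i * along X (fun q => Y q j) p)
    + ∑ i, ∑ j, ∑ k, christoffel f p i j k * Z p i * X p j * Y p k

/-- The products of the vectors of a null tetrad: for the dual coframe the metric reads
`2 θ¹ θ² - 2 θ³ θ⁴`. -/
def nullGram : Matrix (Fin 4) (Fin 4) ℂ :=
  !![0, 1, 0, 0;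
     1, 0, 0, 0;
     0, 0, 0, -1;
     0, 0, -1, 0]

/-- The connection form `ω_{ab}`, evaluated on `X`: here `∇_X e_b = ω^a_b(X) e_a`. The frame is
numbered `e 0 = δ`, `e 1 = δ*`, `e 2 = Δ`, `e 3 = D`, so that for example `ω_{23}` is
`connForm f e 1 2`. -/
def connForm (f : ℂ → ℝ → ℂ) (e : Fin 4 → CField) (a b : Fin 4) (X : CField) : Event → ℂ :=
  ipNabla f (e a) X (e b)

/-- The curvature form `Ω_{ab} = dω_{ab} + ω_{ac} ∧ ω^c_b` of a null tetrad, evaluated on two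
vector fields. Indices are raised with `nullGram`, which is its own inverse. -/
def curvForm (f : ℂ → ℝ → ℂ) (e : Fin 4 → CField) (a b : Fin 4) (X Y : CField) : Event → ℂ :=
  fun p => along X (connForm f e a b Y) p - along Y (connForm f e a b X) p
    - connForm f e a b (bracket X Y) p
    + ∑ c, ∑ d, nullGram c d *
        (connForm f e a c X p * connForm f e d b Y p
          - connForm f e a c Y p * connForm f e d b X p)

/-- The spin coefficient `α`, the `θ²`-component of `-(ω₁₂ + ω₃₄) / 2`. -/
def alpha (f : ℂ → ℝ → ℂ) (e : Fin 4 → CField) : Event → ℂ :=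
  fun p => -(connForm f e 0 1 (e 1) p + connForm f e 2 3 (e 1) p) / 2

/-- The spin coefficient `γ`, the `θ³`-component of `-(ω₁₂ + ω₃₄) / 2`. -/
def gamma (f : ℂ → ℝ → ℂ) (e : Fin 4 → CField) : Event → ℂ :=
  fun p => -(connForm f e 0 1 (e 2) p + connForm f e 2 3 (e 2) p) / 2

/-- The spin coefficient `μ`, the `θ¹`-component of `ω₂₃`. -/
def mu (f : ℂ → ℝ → ℂ) (e : Fin 4 → CField) : Event → ℂ :=
  connForm f e 1 2 (e 0)

/-- The spin coefficient `ν`, the `θ³`-component of `ω₂₃`. -/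
def nu (f : ℂ → ℝ → ℂ) (e : Fin 4 → CField) : Event → ℂ :=
  connForm f e 1 2 (e 2)

/-- The Weyl component `Ψ₄`, the `θ² ∧ θ³`-component of `Ω₂₃`. -/
def psi4 (f : ℂ → ℝ → ℂ) (e : Fin 4 → CField) : Event → ℂ :=
  curvForm f e 1 2 (e 1) (e 2)

/-- `e = (δ, δ*, Δ, D)` is a smooth complex null tetrad on `U`: `δ*` is the conjugate of `δ`, the
fields `Δ` and `D` are real, and the dual coframe satisfies `g = 2 θ¹ θ² - 2 θ³ θ⁴`. -/
structure IsNullTetrad (f : ℂ → ℝ → ℂ) (U : Set Event) (e : Fin 4 → CField) : Prop where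
  smooth : ∀ a i, ContDiffOn ℝ ((⊤ : ℕ∞) : WithTop ℕ∞) (fun p => e a p i) U
  conj_delta : ∀ p ∈ U, e 1 p = conjField (e 0) p
  real_Delta : ∀ p ∈ U, conjField (e 2) p = e 2 p
  real_D : ∀ p ∈ U, conjField (e 3) p = e 3 p
  gram : ∀ p ∈ U, ∀ a b, ip f (e a) (e b) p = nullGram a b

/-- The invariant tetrad of a vacuum pp-wave with `α ≠ 0`: a null tetrad with `Ψ₄ = 1` and `γ = 0`
whose vector `D` is aligned with (and points in the direction of) the covariantly constant null
field `∂_v`, and whose orientation is the one of `∂_ζ, ∂_ζ̄, ∂_u, ∂_v` (this says that `δ`, rather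
than `δ*`, has a `∂_ζ`-component). -/
structure IsNormalizedTetrad (f : ℂ → ℝ → ℂ) (U : Set Event) (e : Fin 4 → CField) : Prop
    extends IsNullTetrad f U e where
  aligned : ∀ p ∈ U, ∃ r : ℝ, 0 < r ∧ e 3 p = ![0, 0, 0, (r : ℂ)]
  oriented : ∀ p ∈ U, e 0 p 0 ≠ 0
  psi4_eq : ∀ p ∈ U, psi4 f e p = 1
  gamma_eq : ∀ p ∈ U, gamma f e p = 0

/-- `A = δ*α / α²`. -/
def invA (f : ℂ → ℝ → ℂ) (e : Fin 4 → CField) : Event → ℂ :=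
  fun p => along (e 1) (alpha f e) p / alpha f e p ^ 2

/-- `M = α μ`. -/
def invM (f : ℂ → ℝ → ℂ) (e : Fin 4 → CField) : Event → ℂ :=
  fun p => alpha f e p * mu f e p

/-- `X̃ = Δ log M* / (1 - A*)`, with `Δ log M* = ΔM* / M*`. -/
def tildeX (f : ℂ → ℝ → ℂ) (e : Fin 4 → CField) : Event → ℂ :=
  fun p => along (e 2) (fun q => star (invM f e q)) p / star (invM f e p)
    / (1 - star (invA f e p))

/-- `ν̃ = ν + X̃ (X̃* + 2μ - A* X̃) / α*`. -/
def tildeNu (f : ℂ → ℝ → ℂ) (e : Fin 4 → CField) : Event → ℂ :=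
  fun p => nu f e p + tildeX f e p *
    (star (tildeX f e p) + 2 * mu f e p - star (invA f e p) * tildeX f e p)
      / star (alpha f e p)

/-- `Υ̃ = Δ(ν̃ / X̃*) - 2ν̃ + 1/α - 4i X̃ X̃₂ / α*`, where `X̃₂ = Im X̃`. -/
def tildeUpsilon (f : ℂ → ℝ → ℂ) (e : Fin 4 → CField) : Event → ℂ :=
  fun p => along (e 2) (fun q => tildeNu f e q / star (tildeX f e q)) p
    - 2 * tildeNu f e p + 1 / alpha f e p
    - 4 * I * tildeX f e p * ((tildeX f e p).im : ℂ) / star (alpha f e p)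

/-- The value of `da ∧ db ∧ dc` at `p` on three tangent vectors. -/
def wedge3 (a b c : Event → ℂ) (p : Event) (x y z : Event) : ℂ :=
  Matrix.det !![fderiv ℝ a p x, fderiv ℝ a p y, fderiv ℝ a p z;
                fderiv ℝ b p x, fderiv ℝ b p y, fderiv ℝ b p z;
                fderiv ℝ c p x, fderiv ℝ c p y, fderiv ℝ c p z]

/-- `z = u^{-ik} ζ`, for `u > 0`. -/
def zB (k : ℝ) (ζ : ℂ) (u : ℝ) : ℂ := exp (-(I * k * (Real.log u : ℂ))) * ζ

/-- `z = e^{iu} ζ`. -/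
def zC (ζ : ℂ) (u : ℝ) : ℂ := exp (I * u) * ζ

/-- `l` is a holomorphic branch of the logarithm on the open set `W`. -/
structure IsLogBranch (l : ℂ → ℂ) (W : Set ℂ) : Prop where
  isOpen : IsOpen W
  holo : DifferentiableOn ℂ l W
  exp_eq : ∀ w ∈ W, exp (l w) = w

/-- On `U`, the function `f` is a solution of type `BP₁₃`, `CP₁₃`, `BE₁₃` or `CE₁₃` with the
function `g` in its linear term. The power `w ^ (i k₁)` is `exp (i k₁ l(w))` for a holomorphic
branch `l` of the logarithm. -/
inductive IsBCPE13 (U : Set Event) (f : ℂ → ℝ → ℂ) (g : ℝ → ℂ) : Prop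
  | BP (k₀ k₁ k : ℝ) (l : ℂ → ℂ) (W : Set ℂ) (hk₀ : k₀ ≠ 0) (hk₁ : k₁ ≠ 0) (hk : k * k₁ ≠ 2)
      (hl : IsLogBranch l W)
      (hU : ∀ p ∈ U, 0 < p.2.1 ∧ (k₀ : ℂ) * zB k p.1 p.2.1 ∈ W)
      (hf : ∀ p ∈ U, f p.1 p.2.1 = exp (I * k₁ * l (k₀ * zB k p.1 p.2.1)) / (p.2.1 : ℂ) ^ 2
        + g p.2.1 / (p.2.1 : ℂ) ^ 2 * zB k p.1 p.2.1)
  | CP (k₀ k₁ : ℝ) (l : ℂ → ℂ) (W : Set ℂ) (hk₀ : k₀ ≠ 0) (hk₁ : k₁ ≠ 0)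
      (hl : IsLogBranch l W)
      (hU : ∀ p ∈ U, (k₀ : ℂ) * zC p.1 p.2.1 ∈ W)
      (hf : ∀ p ∈ U, f p.1 p.2.1 = exp (I * k₁ * l (k₀ * zC p.1 p.2.1))
        + g p.2.1 * zC p.1 p.2.1)
  | BE (k₀ k : ℝ) (hk₀ : k₀ ≠ 0) (hk : k ≠ 0)
      (hU : ∀ p ∈ U, 0 < p.2.1)
      (hf : ∀ p ∈ U, f p.1 p.2.1 = exp (k₀ * zB k p.1 p.2.1) / (p.2.1 : ℂ) ^ 2
        + g p.2.1 / (p.2.1 : ℂ) ^ 2 * zB k p.1 p.2.1)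
  | CE (k₀ : ℝ) (hk₀ : k₀ ≠ 0)
      (hf : ∀ p ∈ U, f p.1 p.2.1 = exp (k₀ * zC p.1 p.2.1) + g p.2.1 * zC p.1 p.2.1)

/-- The other representation of the class `BE₁₃`, in which the factor `u⁻²` has been removed by a
translation of `ζ`. -/
def IsBE13Unscaled (U : Set Event) (f : ℂ → ℝ → ℂ) (g : ℝ → ℂ) : Prop :=
  ∃ k₀ k : ℝ, k₀ ≠ 0 ∧ k ≠ 0 ∧ ∀ p ∈ U, 0 < p.2.1 ∧
    f p.1 p.2.1 = exp (k₀ * zB k p.1 p.2.1) + g p.2.1 * zB k p.1 p.2.1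

end PPWave

end

/-! Write `P`, `R` and `w` for `phase`, `boost` and `velocity`, and put `E = R P` (`spin`).
Alignment and the Gram relations leave only these functions free: up to a `∂_v` part, `δ = P ∂_ζ`
and `R Δ = ∂_u + w ∂_ζ + w̄ ∂_ζ̄`. The normalization then fixes the tetrad up to sign. By
`psi4_eq_div`, `Ψ₄ = 1` means `2E² = f̄''`, primes being `ζ`-derivatives of `f`. Since `2γ = Δ log
E`, the condition `γ = 0` makes `w` the solution of `∂_u f'' + w f''' = 0` (`velocity_eq`).

For the waves considered `w` is affine in `ζ`, `w = cζ - β`, with `c`, `β` depending on `u` only.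
`AffineProfile` records what is needed of them. It yields `μ = c/R`, `X̃ = x/R`, `A* = (c - x̄)/x`
and `ν = N/(E R)` with `N = ∂_u w + c w + f̄'/2`.

Nothing depends on `v`. The forms `dα` and `dμ` annihilate the real field `V = R (Δ + (X̃/α*) δ +
(X̃*/α) δ*)`, equal to `∂_u + (w + 4x f''/f''') ∂_ζ + (w̄ + 4x̄ f̄''/f̄''') ∂_ζ̄` up to a `∂_v`
part, and are independent because `A ≠ 1`. Hence `dα ∧ dμ ∧ dν = 0` exactly when `Vν = 0`. Moreover
`E R Vν` is `defect`, and `Υ̃ = Vν / x̄`. This gives (i) ⇔ (ii) in all cases (`wedge3_iff`,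
`tildeUpsilon_iff`).

For (iii) the families are treated together as `f = s(u) (h(z) + g(u) z)` with `z = t(u) ζ` and
`h''/h'''` affine. In the first four families all terms of `defect` cancel except the one with `g'`,
leaving half the conjugate of `s t g'` (`exists_affineProfile`). -/

noncomputable section

namespace PPWave

open Complex

/-! ### Calculus of Wirtinger derivatives on the space of events -/

/-- `φ` is differentiable at `p` with coordinate derivatives `d`. -/
structure HasCoordDeriv (φ : Event → ℂ) (p : Event) (d : Fin 4 → ℂ) : Prop where
  diff : DifferentiableAt ℝ φ p
  eq : coordDeriv φ p = d

/-- The coordinate derivatives of conjugate functions. -/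
def conjCoord (d : Fin 4 → ℂ) : Fin 4 → ℂ := ![star (d 1), star (d 0), star (d 2), star (d 3)]

theorem DifferentiableAt.hasCoordDeriv {φ : Event → ℂ} {p : Event}
    (h : DifferentiableAt ℝ φ p) : HasCoordDeriv φ p (coordDeriv φ p) := ⟨h, rfl⟩

theorem coordDeriv_congr {φ ψ : Event → ℂ} {p : Event} (h : φ =ᶠ[nhds p] ψ) :
    coordDeriv φ p = coordDeriv ψ p := by
  simp only [coordDeriv, h.fderiv_eq]

theorem along_congr {V : CField} {φ ψ : Event → ℂ} {p : Event} (h : φ =ᶠ[nhds p] ψ) :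
    along V φ p = along V ψ p := by
  simp only [along, coordDeriv_congr h]

theorem fderiv_eq_coordDeriv (φ : Event → ℂ) (p h : Event) :
    fderiv ℝ φ p h = coordDeriv φ p 0 * h.1 + coordDeriv φ p 1 * star h.1
      + coordDeriv φ p 2 * h.2.1 + coordDeriv φ p 3 * h.2.2 := by
  have e : h = h.1.re • ((1 : ℂ), (0 : ℝ), (0 : ℝ)) + h.1.im • (I, (0 : ℝ), (0 : ℝ))
      + h.2.1 • ((0 : ℂ), (1 : ℝ), (0 : ℝ)) + h.2.2 • ((0 : ℂ), (0 : ℝ), (1 : ℝ)) := by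
    refine Prod.ext ?_ (Prod.ext ?_ ?_)
    · simp
    · simp
    · simp
  have hz : h.1 = h.1.re + h.1.im * I := (re_add_im h.1).symm
  have hs : star h.1 = h.1.re - h.1.im * I := by
    apply Complex.ext <;> simp
  rw [hs, e, map_add, map_add, map_add, map_smul, map_smul, map_smul, map_smul]
  rw [← e]
  nth_rw 3 [hz]
  simp only [coordDeriv, Matrix.cons_val, real_smul]
  linear_combination ((h.1.im : ℂ) * fderiv ℝ φ p (I, 0, 0)) * I_sq

namespace HasCoordDeriv

variable {φ ψ : Event → ℂ} {p : Event} {d d' : Fin 4 → ℂ}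

theorem congr (h : HasCoordDeriv φ p d) (e : ψ =ᶠ[nhds p] φ) : HasCoordDeriv ψ p d :=
  ⟨h.diff.congr_of_eventuallyEq e, (coordDeriv_congr e).trans h.eq⟩

theorem congr_on {U : Set Event} (hU : IsOpen U) (hp : p ∈ U) (h : HasCoordDeriv φ p d)
    (e : ∀ q ∈ U, ψ q = φ q) : HasCoordDeriv ψ p d :=
  h.congr (Filter.eventually_of_mem (hU.mem_nhds hp) e)

theorem of_eq (h : HasCoordDeriv φ p d) (e : d = d') : HasCoordDeriv φ p d' := e ▸ h

theorem const (c : ℂ) : HasCoordDeriv (fun _ => c) p 0 := by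
  refine ⟨differentiableAt_const c, ?_⟩
  ext i; fin_cases i <;> simp [coordDeriv]

theorem add (h : HasCoordDeriv φ p d) (h' : HasCoordDeriv ψ p d') :
    HasCoordDeriv (fun q => φ q + ψ q) p (fun i => d i + d' i) := by
  refine ⟨h.diff.add h'.diff, ?_⟩
  rw [← h.eq, ← h'.eq]
  ext i; fin_cases i <;> simp [coordDeriv, fderiv_fun_add h.diff h'.diff] <;> ring

theorem neg (h : HasCoordDeriv φ p d) :
    HasCoordDeriv (fun q => -φ q) p (fun i => -d i) := by
  refine ⟨h.diff.neg, ?_⟩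
  rw [← h.eq]
  ext i; fin_cases i <;> simp [coordDeriv, fderiv_fun_neg] <;> ring

theorem sub (h : HasCoordDeriv φ p d) (h' : HasCoordDeriv ψ p d') :
    HasCoordDeriv (fun q => φ q - ψ q) p (fun i => d i - d' i) := by
  simpa only [sub_eq_add_neg] using h.add h'.neg

theorem mul (h : HasCoordDeriv φ p d) (h' : HasCoordDeriv ψ p d') :
    HasCoordDeriv (fun q => φ q * ψ q) p (fun i => φ p * d' i + ψ p * d i) := by
  refine ⟨h.diff.mul h'.diff, ?_⟩
  rw [← h.eq, ← h'.eq]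
  ext i; fin_cases i <;> simp [coordDeriv, fderiv_fun_mul h.diff h'.diff] <;> ring

theorem const_mul (c : ℂ) (h : HasCoordDeriv φ p d) :
    HasCoordDeriv (fun q => c * φ q) p (fun i => c * d i) := by
  simpa using (const c).mul h

theorem comp_holo {k : ℂ → ℂ} {k' : ℂ} (hk : HasDerivAt k k' (φ p)) (h : HasCoordDeriv φ p d) :
    HasCoordDeriv (fun q => k (φ q)) p (fun i => k' * d i) := by
  have H : HasFDerivAt (fun q => k (φ q)) (k' • fderiv ℝ φ p) p := by
    have := hk.comp_hasFDerivAt_of_eq (𝕜 := ℝ) p h.diff.hasFDerivAt rfl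
    exact this
  refine ⟨H.differentiableAt, ?_⟩
  rw [← h.eq]
  ext i; fin_cases i <;> simp [coordDeriv, H.fderiv] <;> ring

theorem inv (h : HasCoordDeriv φ p d) (h0 : φ p ≠ 0) :
    HasCoordDeriv (fun q => (φ q)⁻¹) p (fun i => -((φ p)⁻¹ * (φ p)⁻¹ * d i)) :=
  (comp_holo (hasDerivAt_inv h0) h).of_eq (by ext i; field_simp)

theorem conj (h : HasCoordDeriv φ p d) :
    HasCoordDeriv (fun q => star (φ q)) p (conjCoord d) := by
  have H : HasFDerivAt (fun q => star (φ q)) ((conjCLE : ℂ →L[ℝ] ℂ).comp (fderiv ℝ φ p)) p :=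
    (conjCLE : ℂ →L[ℝ] ℂ).hasFDerivAt.comp p h.diff.hasFDerivAt
  refine ⟨H.differentiableAt, ?_⟩
  rw [← h.eq, coordDeriv, H.fderiv]
  ext i; fin_cases i <;> (simp [coordDeriv, conjCoord]; try ring)

theorem along (h : HasCoordDeriv φ p d) (V : CField) : along V φ p = ∑ i, V p i * d i := by
  rw [PPWave.along, h.eq]

theorem of_u {s : ℝ → ℂ} {s' : ℂ} (h : HasDerivAt s s' p.2.1) :
    HasCoordDeriv (fun q => s q.2.1) p ![0, 0, s', 0] := by
  have H : HasFDerivAt (fun q : Event => s q.2.1)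
      ((ContinuousLinearMap.toSpanSingleton ℝ s').comp
        ((ContinuousLinearMap.fst ℝ ℝ ℝ).comp (ContinuousLinearMap.snd ℝ ℂ (ℝ × ℝ)))) p :=
    h.hasFDerivAt.comp p
      ((ContinuousLinearMap.fst ℝ ℝ ℝ).comp (ContinuousLinearMap.snd ℝ ℂ (ℝ × ℝ))).hasFDerivAt
  refine ⟨H.differentiableAt, ?_⟩
  ext i; fin_cases i <;> simp [coordDeriv, H.fderiv]

theorem zeta : HasCoordDeriv (fun q => q.1) p ![1, 0, 0, 0] := by
  have H : HasFDerivAt (fun q : Event => q.1) (ContinuousLinearMap.fst ℝ ℂ (ℝ × ℝ)) p :=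
    (ContinuousLinearMap.fst ℝ ℂ (ℝ × ℝ)).hasFDerivAt
  refine ⟨H.differentiableAt, ?_⟩
  ext i; fin_cases i <;> simp [coordDeriv, H.fderiv]

end HasCoordDeriv

/-- The infinitely differentiable functions on an open set of events. -/
def SmoothOn (φ : Event → ℂ) (U : Set Event) : Prop :=
  ContDiffOn ℝ ((⊤ : ℕ∞) : WithTop ℕ∞) φ U

namespace SmoothOn

variable {φ ψ : Event → ℂ} {U : Set Event}

theorem hasCoordDeriv (h : SmoothOn φ U) (hU : IsOpen U) {p : Event} (hp : p ∈ U) :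
    HasCoordDeriv φ p (PPWave.coordDeriv φ p) :=
  ⟨(h.contDiffAt (hU.mem_nhds hp)).differentiableAt (by simp), rfl⟩

theorem coordDeriv (h : SmoothOn φ U) (hU : IsOpen U) (i : Fin 4) :
    SmoothOn (fun p => PPWave.coordDeriv φ p i) U := by
  have H (v : Event) : SmoothOn (fun p => fderiv ℝ φ p v) U :=
    ((contDiffOn_infty_iff_fderiv_of_isOpen hU).1 h).2.clm_apply contDiffOn_const
  unfold SmoothOn at *
  fin_cases i <;> simp only [PPWave.coordDeriv]
  · exact ((H _).sub (contDiffOn_const.mul (H _))).div_const 2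
  · exact ((H _).add (contDiffOn_const.mul (H _))).div_const 2
  · exact H _
  · exact H _

theorem along (h : SmoothOn φ U) (hU : IsOpen U) {V : CField} (hV : ∀ i, SmoothOn (fun p => V p i) U) :
    SmoothOn (along V φ) U :=
  ContDiffOn.sum fun i _ => (hV i).mul (h.coordDeriv hU i)

end SmoothOn

theorem coordDeriv_comm {φ : Event → ℂ} {U : Set Event} (h : SmoothOn φ U) (hU : IsOpen U)
    {p : Event} (hp : p ∈ U) (i j : Fin 4) :
    coordDeriv (fun q => coordDeriv φ q i) p j = coordDeriv (fun q => coordDeriv φ q j) p i := by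
  have hd : ContDiffAt ℝ ((⊤ : ℕ∞) : WithTop ℕ∞) φ p := h.contDiffAt (hU.mem_nhds hp)
  have hs : IsSymmSndFDerivAt ℝ φ p := hd.isSymmSndFDerivAt (by
    simpa using (WithTop.coe_le_coe.2 (le_top : (2 : ℕ∞) ≤ ⊤)))
  have hd2 : DifferentiableAt ℝ (fderiv ℝ φ) p :=
    (hd.fderiv_right (m := 1) (by norm_cast)).differentiableAt (by simp)
  have key (v w : Event) : fderiv ℝ (fun q => fderiv ℝ φ q v) p w
      = fderiv ℝ (fderiv ℝ φ) p w v := by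
    rw [fderiv_clm_apply hd2 (differentiableAt_const v)]
    simp
  have kd (v : Event) : DifferentiableAt ℝ (fun q => fderiv ℝ φ q v) p :=
    hd2.clm_apply (differentiableAt_const v)
  have k (v : Event) : HasCoordDeriv (fun q => fderiv ℝ φ q v) p
      (coordDeriv (fun q => fderiv ℝ φ q v) p) := ⟨kd v, rfl⟩
  have c0 := (((k (1, 0, 0)).sub ((k (I, 0, 0)).const_mul I)).const_mul (1 / 2)).eq
  have c1 := (((k (1, 0, 0)).add ((k (I, 0, 0)).const_mul I)).const_mul (1 / 2)).eq
  have f0 : (fun q => coordDeriv φ q 0) = fun q => 1 / 2 * (fderiv ℝ φ q (1, 0, 0) -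
      I * fderiv ℝ φ q (I, 0, 0)) := by
    ext q; simp [coordDeriv]; ring
  have f1 : (fun q => coordDeriv φ q 1) = fun q => 1 / 2 * (fderiv ℝ φ q (1, 0, 0) +
      I * fderiv ℝ φ q (I, 0, 0)) := by
    ext q; simp [coordDeriv]; ring
  have f2 : (fun q => coordDeriv φ q 2) = fun q => fderiv ℝ φ q (0, 1, 0) := rfl
  have f3 : (fun q => coordDeriv φ q 3) = fun q => fderiv ℝ φ q (0, 0, 1) := rfl
  have s1 := hs.eq (1, 0, 0) (I, 0, 0)
  have s2 := hs.eq (1, 0, 0) (0, 1, 0)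
  have s3 := hs.eq (1, 0, 0) (0, 0, 1)
  have s4 := hs.eq (I, 0, 0) (0, 1, 0)
  have s5 := hs.eq (I, 0, 0) (0, 0, 1)
  have s6 := hs.eq (0, 1, 0) (0, 0, 1)
  fin_cases i <;> fin_cases j <;>
    simp only [Fin.zero_eta, Fin.mk_one, Fin.reduceFinMk, f0, f1, f2, f3, c0, c1] <;>
    simp only [coordDeriv, key, Matrix.cons_val, s1, s2, s3, s4, s5, s6] <;> ring

/-- By the symmetry of second derivatives, only first derivatives of `φ` survive. It is applied to
the velocity, to remove its second derivatives from the curvature form. -/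
theorem along_along_sub {φ : Event → ℂ} {U : Set Event} (h : SmoothOn φ U) (hU : IsOpen U)
    {p : Event} (hp : p ∈ U) {X Y : CField} (hX : ∀ i, SmoothOn (fun p => X p i) U)
    (hY : ∀ i, SmoothOn (fun p => Y p i) U) :
    along X (along Y φ) p - along Y (along X φ) p = along (bracket X Y) φ p := by
  have H {Z : CField} (hZ : ∀ i, SmoothOn (fun p => Z p i) U) (j : Fin 4) :
      coordDeriv (along Z φ) p j = ∑ i, (Z p i * coordDeriv (fun q => coordDeriv φ q i) p j
        + coordDeriv φ p i * coordDeriv (fun q => Z q i) p j) := by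
    have k (i : Fin 4) := ((hZ i).hasCoordDeriv hU hp).mul ((h.coordDeriv hU i).hasCoordDeriv hU hp)
    have := (((k 0).add (k 1)).add (k 2)).add (k 3)
    have e : along Z φ = fun q => Z q 0 * coordDeriv φ q 0 + Z q 1 * coordDeriv φ q 1
        + Z q 2 * coordDeriv φ q 2 + Z q 3 * coordDeriv φ q 3 := by
      ext q; simp [along, Fin.sum_univ_four]
    rw [e, this.eq, Fin.sum_univ_four]
  have c (i j : Fin 4) := coordDeriv_comm h hU hp i j
  rw [along, along]
  simp only [H hX, H hY]
  simp only [along, bracket, Fin.sum_univ_four]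
  rw [c 1 0, c 2 0, c 3 0, c 2 1, c 3 1, c 3 2]
  ring

/-! ### Null tetrads aligned with `∂_v` -/

section Components

variable {f : ℂ → ℝ → ℂ} {U : Set Event} {e : Fin 4 → CField}

/-- The rotation part `dζ(δ)` of a tetrad. -/
def phase (e : Fin 4 → CField) : Event → ℂ := fun p => e 0 p 0

/-- The boost part `dv(D)` of a tetrad. -/
def boost (e : Fin 4 → CField) : Event → ℂ := fun p => e 3 p 3

/-- The velocity `dζ(Δ) / du(Δ)` of a tetrad. -/
def velocity (e : Fin 4 → CField) : Event → ℂ := fun p => e 3 p 3 * e 2 p 0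

/-- The product of the rotation and boost parts of a tetrad. -/
def spin (e : Fin 4 → CField) : Event → ℂ := fun p => boost e p * phase e p

/-- Products with `D = R ∂_v` read off the `∂_u`-components. Then `g(δ, δ) = 0` and `dζ(δ) ≠ 0`
remove the `∂_ζ̄`-component of `δ`, `g(δ, δ*) = 1` gives `|P| = 1`, and `g(δ, Δ) = 0` fixes the
`∂_v`-component of `δ`. That of `Δ` is never needed. -/
theorem IsNormalizedTetrad.components (he : IsNormalizedTetrad f U e) {p : Event} (hp : p ∈ U) :
    phase e p * star (phase e p) = 1 ∧ star (boost e p) = boost e p ∧ boost e p ≠ 0 ∧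
    e 0 p = ![phase e p, 0, 0, phase e p * star (velocity e p)] ∧
    e 1 p = ![0, star (phase e p), 0, star (phase e p) * velocity e p] ∧
    (e 2 p 0 = velocity e p / boost e p ∧ e 2 p 1 = star (velocity e p) / boost e p ∧
      e 2 p 2 = 1 / boost e p) ∧
    e 3 p = ![0, 0, 0, boost e p] := by
  obtain ⟨r, hr, h3⟩ := he.aligned p hp
  have hP := he.oriented p hp
  have h1 := he.conj_delta p hp
  have h2 := he.real_Delta p hp
  have hrr : boost e p = r := by simp [boost, h3]
  have hr0 : (r : ℂ) ≠ 0 := by exact_mod_cast hr.ne'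
  have g03 := he.gram p hp 0 3
  have g23 := he.gram p hp 2 3
  have g00 := he.gram p hp 0 0
  have g01 := he.gram p hp 0 1
  have g02 := he.gram p hp 0 2
  have c1 (i) : e 1 p i = conjField (e 0) p i := by rw [h1]
  have c2 : star (e 2 p 0) = e 2 p 1 := by
    have := congrFun h2 1; simpa [conjField] using this
  simp [ip, metric, nullGram, Fin.sum_univ_four, h3] at g03 g23
  have z02 : e 0 p 2 = 0 := by
    rcases g03 with h | h
    · exact h
    · exact absurd h hr.ne'
  have z22 : e 2 p 2 = 1 / r := by
    rw [eq_div_iff hr0]; linear_combination g23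
  simp [ip, metric, nullGram, Fin.sum_univ_four, z02] at g00
  have z01 : e 0 p 1 = 0 := by
    have : e 0 p 0 * e 0 p 1 = 0 := by linear_combination g00 / 2
    exact (mul_eq_zero.1 this).resolve_left hP
  simp [ip, metric, nullGram, Fin.sum_univ_four, z02, z01, c1, conjField] at g01
  simp [ip, metric, nullGram, Fin.sum_univ_four, z02, z01, z22, ← c2] at g02
  have hvel : velocity e p = r * e 2 p 0 := by simp [velocity, h3]
  have hsv : star (velocity e p) = r * star (e 2 p 0) := by
    rw [hvel, star_mul']; simp
  have z03 : e 0 p 3 = phase e p * star (velocity e p) := by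
    rw [hsv, phase, star_def]
    field_simp at g02
    linear_combination -g02
  refine ⟨by simpa [phase] using g01, by rw [hrr]; simp, by rw [hrr]; exact hr0, ?_, ?_, ⟨?_, ?_, ?_⟩, ?_⟩
  · ext i; fin_cases i <;> simp [z01, z02, z03, phase]
  · ext i; fin_cases i <;> simp [c1, conjField, z01, z02, z03, phase]
  · rw [hrr, hvel]; field_simp
  · rw [hrr, hsv, ← c2]; field_simp
  · rw [hrr, z22]
  · rw [hrr, h3]

end Components

/-- On `U`, the function `φ` has the derivatives `∂_ζ φ = φ₁` and `∂_u φ = φu`, and is holomorphic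
in `ζ` and independent of `v`. -/
def HasHoloDeriv (U : Set Event) (φ φ₁ φu : Event → ℂ) : Prop :=
  ∀ p ∈ U, HasCoordDeriv φ p ![φ₁ p, 0, φu p, 0]

/-! ### Levi-Civita connection forms -/

section Connection

variable {f : ℂ → ℝ → ℂ} {U : Set Event} {e : Fin 4 → CField} {f₁ fu : Event → ℂ}

theorem metric_two_two (hf : HasHoloDeriv U (fun q => f q.1 q.2.1) f₁ fu) {p : Event}
    (hp : p ∈ U) : coordDeriv (fun q => metric f q 2 2) p
      = ![-f₁ p, -star (f₁ p), -(fu p + star (fu p)), 0] := by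
  have h := ((hf p hp).add (hf p hp).conj).neg.eq
  have e : (fun q => metric f q 2 2) = fun q : Event => -(f q.1 q.2.1 + star (f q.1 q.2.1)) := rfl
  rw [e, h]
  ext i; fin_cases i <;> simp [conjCoord]

/-- The coefficient of `du²` is the only non-constant entry of the metric, so every Christoffel
symbol is built from its derivatives. -/
theorem ipNabla_eq (hf : HasHoloDeriv U (fun q => f q.1 q.2.1) f₁ fu) {p : Event}
    (hp : p ∈ U) (Z X Y : CField) : ipNabla f Z X Y p =
      (Z p 0 * along X (fun q => Y q 1) p + Z p 1 * along X (fun q => Y q 0) p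
        - (f p.1 p.2.1 + star (f p.1 p.2.1)) * Z p 2 * along X (fun q => Y q 2) p
        - Z p 2 * along X (fun q => Y q 3) p - Z p 3 * along X (fun q => Y q 2) p)
      + (-(Z p 2 * X p 2 * (f₁ p * Y p 0 + star (f₁ p) * Y p 1))
        - Z p 2 * Y p 2 * (f₁ p * X p 0 + star (f₁ p) * X p 1)
        - (fu p + star (fu p)) * Z p 2 * X p 2 * Y p 2
        + X p 2 * Y p 2 * (f₁ p * Z p 0 + star (f₁ p) * Z p 1)) / 2 := by
  have m := metric_two_two hf hp
  have k (c : ℂ) : coordDeriv (fun _ => c) p = 0 := (HasCoordDeriv.const c).eq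
  have k' (i j : Fin 4) (h : i ≠ 2 ∨ j ≠ 2) : coordDeriv (fun q => metric f q i j) p = 0 := by
    have : ∃ c, ∀ q, metric f q i j = c := by
      fin_cases i <;> fin_cases j <;> simp [metric] at h ⊢
    obtain ⟨c, hc⟩ := this
    simp only [hc, k]
  have C (i j l : Fin 4) : christoffel f p i j l =
      ((if i = 2 ∧ l = 2 then coordDeriv (fun q => metric f q 2 2) p j else 0)
      + (if i = 2 ∧ j = 2 then coordDeriv (fun q => metric f q 2 2) p l else 0)
      - (if j = 2 ∧ l = 2 then coordDeriv (fun q => metric f q 2 2) p i else 0)) / 2 := by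
    have k2 (i j l : Fin 4) : coordDeriv (fun q => metric f q i j) p l
        = if i = 2 ∧ j = 2 then coordDeriv (fun q => metric f q 2 2) p l else 0 := by
      split_ifs with h
      · rw [h.1, h.2]
      · rw [k' i j (by tauto)]; rfl
    rw [christoffel, k2 i l, k2 i j, k2 j l]
  simp only [ipNabla, C, m]
  simp [Fin.sum_univ_four, metric]
  ring

theorem along_of_forall_eq_zero (hU : IsOpen U) {p : Event} (hp : p ∈ U) (X : CField)
    {φ : Event → ℂ} (h : ∀ q ∈ U, φ q = 0) : along X φ p = 0 := by
  rw [((HasCoordDeriv.const 0).congr_on hU hp h).along]; simp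

end Connection

section Smooth

variable {f : ℂ → ℝ → ℂ} {U : Set Event} {e : Fin 4 → CField}

theorem IsNullTetrad.smoothOn_phase (he : IsNullTetrad f U e) : SmoothOn (phase e) U :=
  he.smooth 0 0

theorem IsNullTetrad.smoothOn_boost (he : IsNullTetrad f U e) : SmoothOn (boost e) U :=
  he.smooth 3 3

theorem IsNullTetrad.smoothOn_velocity (he : IsNullTetrad f U e) : SmoothOn (velocity e) U :=
  (he.smooth 3 3).mul (he.smooth 2 0)

theorem IsNullTetrad.smoothOn_spin (he : IsNullTetrad f U e) : SmoothOn (spin e) U :=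
  (he.smooth 3 3).mul (he.smooth 0 0)

end Smooth

section Forms

variable {f : ℂ → ℝ → ℂ} {U : Set Event} {e : Fin 4 → CField} {f₁ fu : Event → ℂ} {p : Event}

theorem along_mul {φ ψ : Event → ℂ} {d d' : Fin 4 → ℂ} (h : HasCoordDeriv φ p d)
    (h' : HasCoordDeriv ψ p d') (X : CField) :
    along X (fun q => φ q * ψ q) p = φ p * along X ψ p + ψ p * along X φ p := by
  rw [(h.mul h').along, h.along, h'.along, Finset.mul_sum, Finset.mul_sum, ← Finset.sum_add_distrib]
  exact Finset.sum_congr rfl fun i _ => by ring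

theorem along_add {φ ψ : Event → ℂ} {d d' : Fin 4 → ℂ} (h : HasCoordDeriv φ p d)
    (h' : HasCoordDeriv ψ p d') (X : CField) :
    along X (fun q => φ q + ψ q) p = along X φ p + along X ψ p := by
  rw [(h.add h').along, h.along, h'.along, ← Finset.sum_add_distrib]
  exact Finset.sum_congr rfl fun i _ => by ring

variable (hU : IsOpen U) (he : IsNormalizedTetrad f U e)
  (hf : HasHoloDeriv U (fun q => f q.1 q.2.1) f₁ fu)

include hU he hf

theorem connForm_zero_one (hp : p ∈ U) (X : CField) :
    connForm f e 0 1 X p = -(star (phase e p) * along X (phase e) p) := by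
  have hc {q} (hq : q ∈ U) := he.components hq
  obtain ⟨-, -, -, h0, h1, -, -⟩ := hc hp
  have z : along X (fun q => e 1 q 2) p = 0 :=
    along_of_forall_eq_zero hU hp X fun q hq => by simp [(hc hq).2.2.2.2.1]
  have hP := he.smoothOn_phase.hasCoordDeriv hU hp
  have hP' : HasCoordDeriv (fun q => e 1 q 1) p _ :=
    hP.conj.congr_on hU hp fun q hq => by simp [(hc hq).2.2.2.2.1]
  have u : along X (fun q => phase e q * e 1 q 1) p = 0 := by
    -- Differentiating `P P̄ = 1` expresses the derivative of `P̄` through that of `P`.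
    rw [((HasCoordDeriv.const 1).congr_on hU hp (ψ := fun q => phase e q * e 1 q 1)
      fun q hq => by simpa [(hc hq).2.2.2.2.1] using (hc hq).1).along]
    simp
  rw [along_mul hP hP'] at u
  rw [connForm, ipNabla_eq hf hp, z, h0, h1]
  simp [h1] at u ⊢
  linear_combination u

theorem connForm_one_zero (hp : p ∈ U) (X : CField) :
    connForm f e 1 0 X p = star (phase e p) * along X (phase e) p := by
  have hc {q} (hq : q ∈ U) := he.components hq
  obtain ⟨-, -, -, h0, h1, -, -⟩ := hc hp
  have z : along X (fun q => e 0 q 2) p = 0 :=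
    along_of_forall_eq_zero hU hp X fun q hq => by simp [(hc hq).2.2.2.1]
  rw [connForm, ipNabla_eq hf hp, z, h0, h1]
  simp [show (fun q => e 0 q 0) = phase e from rfl]

theorem connForm_one_one (hp : p ∈ U) (X : CField) : connForm f e 1 1 X p = 0 := by
  have hc {q} (hq : q ∈ U) := he.components hq
  obtain ⟨-, -, -, h0, h1, -, -⟩ := hc hp
  have z : along X (fun q => e 1 q 2) p = 0 :=
    along_of_forall_eq_zero hU hp X fun q hq => by simp [(hc hq).2.2.2.2.1]
  have z' : along X (fun q => e 1 q 0) p = 0 :=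
    along_of_forall_eq_zero hU hp X fun q hq => by simp [(hc hq).2.2.2.2.1]
  rw [connForm, ipNabla_eq hf hp, z, z', h1]
  simp

theorem connForm_one_three (hp : p ∈ U) (X : CField) : connForm f e 1 3 X p = 0 := by
  have hc {q} (hq : q ∈ U) := he.components hq
  obtain ⟨-, -, -, h0, h1, -, h3⟩ := hc hp
  have z : along X (fun q => e 3 q 2) p = 0 :=
    along_of_forall_eq_zero hU hp X fun q hq => by simp [(hc hq).2.2.2.2.2.2]
  have z' : along X (fun q => e 3 q 0) p = 0 :=
    along_of_forall_eq_zero hU hp X fun q hq => by simp [(hc hq).2.2.2.2.2.2]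
  rw [connForm, ipNabla_eq hf hp, z, z', h1, h3]
  simp

theorem connForm_two_three (hp : p ∈ U) (X : CField) :
    connForm f e 2 3 X p = -(along X (boost e) p / boost e p) := by
  have hc {q} (hq : q ∈ U) := he.components hq
  obtain ⟨-, -, -, h0, h1, ⟨-, -, h22⟩, h3⟩ := hc hp
  have z (i : Fin 4) (hi : i ≠ 3) : along X (fun q => e 3 q i) p = 0 :=
    along_of_forall_eq_zero hU hp X fun q hq => by
      rw [(hc hq).2.2.2.2.2.2]; fin_cases i <;> simp at hi ⊢
  rw [connForm, ipNabla_eq hf hp, z 0 (by decide), z 1 (by decide), z 2 (by decide), h3, h22]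
  simp
  rw [show (fun q => e 3 q 3) = boost e from rfl]
  ring

omit hf in
theorem along_two_two (hp : p ∈ U) (X : CField) :
    along X (fun q => e 2 q 2) p = -(along X (boost e) p / boost e p ^ 2) := by
  have hc {q} (hq : q ∈ U) := he.components hq
  have hr := (hc hp).2.2.1
  have hR := he.smoothOn_boost.hasCoordDeriv hU hp
  rw [((hR.inv hr).congr_on hU hp fun q hq => by
    rw [(hc hq).2.2.2.2.2.1.2.2, one_div]).along, hR.along, Finset.sum_div, ← Finset.sum_neg_distrib]
  exact Finset.sum_congr rfl fun i _ => by field_simp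

theorem connForm_three_two (hp : p ∈ U) (X : CField) :
    connForm f e 3 2 X p = along X (boost e) p / boost e p := by
  have hc {q} (hq : q ∈ U) := he.components hq
  obtain ⟨-, -, hr, h0, h1, ⟨-, -, h22⟩, h3⟩ := hc hp
  rw [connForm, ipNabla_eq hf hp, along_two_two hU he hp, h3]
  simp
  field_simp

theorem connForm_one_two (hp : p ∈ U) (X : CField) :
    connForm f e 1 2 X p = (spin e p)⁻¹ *
      (along X (velocity e) p + X p 2 * (star (f₁ p) / 2)) := by
  have hc {q} (hq : q ∈ U) := he.components hq
  obtain ⟨hP, -, hr, h0, h1, ⟨h20, h21, h22⟩, h3⟩ := hc hp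
  have hP0 : phase e p ≠ 0 := left_ne_zero_of_mul_eq_one hP
  have hR := he.smoothOn_boost.hasCoordDeriv hU hp
  have h2 : HasCoordDeriv (fun q => e 2 q 0) p _ :=
    SmoothOn.hasCoordDeriv (he.smooth 2 0) hU hp
  have hw : along X (velocity e) p = _ := along_mul hR h2 X
  have hsP : star (phase e p) = (phase e p)⁻¹ := eq_inv_of_mul_eq_one_right hP
  rw [connForm, ipNabla_eq hf hp, along_two_two hU he hp, hw, spin, h1, hsP, h20, h22]
  simp
  field_simp

end Forms

/-! ### The Weyl component `Ψ₄` -/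

section Curvature

variable {f : ℂ → ℝ → ℂ} {U : Set Event} {e : Fin 4 → CField} {f₁ fu f₂ f₁u : Event → ℂ}
  {p : Event}

/-- By `connForm_one_two`, `E ω₂₃ = dw + (f̄'/2) du`. Its exterior derivative contains no `d²w`. The
terms with `dE` cancel against the quadratic part of the curvature, which is the sum of the rotation
form `ω₂₁` and the boost form `ω₄₃`, that is, `dE/E`. Only `d(f̄'/2) ∧ du` remains. -/
theorem psi4_eq_div (hU : IsOpen U) (he : IsNormalizedTetrad f U e)
    (hf : HasHoloDeriv U (fun q => f q.1 q.2.1) f₁ fu) (hf₁ : HasHoloDeriv U f₁ f₂ f₁u)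
    (hp : p ∈ U) : psi4 f e p = star (f₂ p) / (2 * spin e p ^ 2) := by
  have hc {q} (hq : q ∈ U) := he.components hq
  obtain ⟨hP, -, hr, h0, h1, ⟨h20, h21, h22⟩, h3⟩ := hc hp
  have hP0 : phase e p ≠ 0 := left_ne_zero_of_mul_eq_one hP
  have hE0 : spin e p ≠ 0 := mul_ne_zero hr hP0
  have hsP : star (phase e p) = (phase e p)⁻¹ := eq_inv_of_mul_eq_one_right hP
  have hE := he.smoothOn_spin.hasCoordDeriv hU hp
  have hm := (hf₁ p hp).conj.const_mul (1 / 2)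
  have hs (Y : Fin 4) : ∀ i, SmoothOn (fun p => e Y p i) U := he.smooth Y
  have hv (Y : Fin 4) := SmoothOn.hasCoordDeriv (he.smoothOn_velocity.along hU (hs Y)) hU hp
  have C (X Y : Fin 4) : along (e X) (connForm f e 1 2 (e Y)) p =
      (spin e p)⁻¹ * (along (e X) (along (e Y) (velocity e)) p
        + (e Y p 2 * along (e X) (fun q => 1 / 2 * star (f₁ q)) p
          + 1 / 2 * star (f₁ p) * along (e X) (fun q => e Y q 2) p))
      + (along (e Y) (velocity e) p + e Y p 2 * (1 / 2 * star (f₁ p))) *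
        -((spin e p)⁻¹ * (spin e p)⁻¹ * along (e X) (spin e) p) := by
    have h2 := SmoothOn.hasCoordDeriv (hs Y 2) hU hp
    have : connForm f e 1 2 (e Y) =ᶠ[nhds p] fun q => (spin e q)⁻¹ *
        (along (e Y) (velocity e) q + e Y q 2 * (1 / 2 * star (f₁ q))) :=
      Filter.eventually_of_mem (hU.mem_nhds hp) fun q hq => by
        rw [connForm_one_two hU he hf hq]; ring
    rw [along_congr this, along_mul (hE.inv hE0) ((hv Y).add (h2.mul hm)),
      along_add (hv Y) (h2.mul hm), along_mul h2 hm]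
    congr 2
    rw [(hE.inv hE0).along, hE.along, Finset.mul_sum, ← Finset.sum_neg_distrib]
    exact Finset.sum_congr rfl fun i _ => by ring
  have B := along_along_sub he.smoothOn_velocity hU hp (hs 1) (hs 2)
  have hSp (X : CField) : along X (spin e) p =
      boost e p * along X (phase e) p + phase e p * along X (boost e) p :=
    along_mul (he.smoothOn_boost.hasCoordDeriv hU hp) (he.smoothOn_phase.hasCoordDeriv hU hp) X
  have hb : bracket (e 1) (e 2) p 2 = along (e 1) (fun q => e 2 q 2) p -
    along (e 2) (fun q => e 1 q 2) p := rfl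
  have h12 : e 1 p 2 = 0 := by simp [h1]
  rw [psi4, curvForm, C, C, connForm_one_two hU he hf hp (bracket (e 1) (e 2)), hb, ← B]
  simp only [Fin.sum_univ_four, nullGram]
  simp [-star_def, connForm_one_zero hU he hf hp, connForm_one_one hU he hf hp,
    connForm_three_two hU he hf hp, connForm_one_three hU he hf hp,
    connForm_one_two hU he hf hp, hSp, hsP, h12]
  have hX : along (e 1) (fun q => 1 / 2 * star (f₁ q)) p = (phase e p)⁻¹ * (star (f₂ p) / 2) := by
    rw [hm.along]
    simp [Fin.sum_univ_four, conjCoord, h1, hsP]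
    exact Or.inl (by ring)
  simp at hX
  rw [hX, h22]
  simp only [spin]
  field_simp
  ring

end Curvature

/-! ### Logarithmic derivatives, and the spin coefficients of waves with affine velocity -/

/-- `φ` has the logarithmic coordinate derivatives `d` at `p`. -/
def HasLogDeriv (φ : Event → ℂ) (p : Event) (d : Fin 4 → ℂ) : Prop :=
  HasCoordDeriv φ p (fun i => φ p * d i)

namespace HasLogDeriv

variable {φ ψ : Event → ℂ} {p : Event} {d d' : Fin 4 → ℂ}

theorem of_hasCoordDeriv (h : HasCoordDeriv φ p d) (h0 : φ p ≠ 0) :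
    HasLogDeriv φ p (fun i => d i / φ p) :=
  h.of_eq (by ext i; field_simp)

theorem of_eq (h : HasLogDeriv φ p d) (e : d = d') : HasLogDeriv φ p d' := e ▸ h

theorem congr_on {U : Set Event} (hU : IsOpen U) (hp : p ∈ U) (h : HasLogDeriv φ p d)
    (e : ∀ q ∈ U, ψ q = φ q) : HasLogDeriv ψ p d :=
  (HasCoordDeriv.congr_on hU hp h e).of_eq (by rw [e p hp])

theorem mul (h : HasLogDeriv φ p d) (h' : HasLogDeriv ψ p d') :
    HasLogDeriv (fun q => φ q * ψ q) p (fun i => d i + d' i) :=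
  (HasCoordDeriv.mul h h').of_eq (by ext i; ring)

theorem inv (h : HasLogDeriv φ p d) (h0 : φ p ≠ 0) :
    HasLogDeriv (fun q => (φ q)⁻¹) p (fun i => -d i) :=
  (HasCoordDeriv.inv h h0).of_eq (by ext i; field_simp)

theorem const_mul (c : ℂ) (h : HasLogDeriv φ p d) : HasLogDeriv (fun q => c * φ q) p d :=
  (HasCoordDeriv.const_mul c h).of_eq (by ext i; ring)

theorem conj (h : HasLogDeriv φ p d) : HasLogDeriv (fun q => star (φ q)) p (conjCoord d) :=
  (HasCoordDeriv.conj h).of_eq (by ext i; fin_cases i <;> simp [conjCoord])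

/-- The normalization determines only `E²` and `R² = E Ē`. Logarithmic derivatives pass to the
square roots without a choice of branch. -/
theorem of_mul_self (hd : DifferentiableAt ℝ φ p) (h0 : φ p ≠ 0)
    (h : HasLogDeriv (fun q => φ q * φ q) p d) : HasLogDeriv φ p (fun i => d i / 2) := by
  have e := ((DifferentiableAt.hasCoordDeriv hd).mul (DifferentiableAt.hasCoordDeriv hd)).eq
  refine ⟨hd, ?_⟩
  ext i
  have := congrFun (e.symm.trans h.eq) i
  have h2 : φ p * (coordDeriv φ p i - φ p * (d i / 2)) = 0 := by linear_combination this / 2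
  exact sub_eq_zero.1 ((mul_eq_zero.1 h2).resolve_left h0)

end HasLogDeriv

/-- The data of a vacuum pp-wave for which the velocity `w` of the invariant tetrad, the solution of
`∂_u f'' + w f''' = 0`, satisfies `w'' = 0` and `∂_u log w' = x + x̄`, where `x` is a function of `u`
that is a multiple of the invariant `X̃`. -/
structure AffineProfile (U : Set Event) (f : ℂ → ℝ → ℂ)
    (f₁ f₂ f₃ f₄ fu f₁u w c wu wuu x : Event → ℂ) : Prop where
  deriv_zero : HasHoloDeriv U (fun q => f q.1 q.2.1) f₁ fu
  deriv_one : HasHoloDeriv U f₁ f₂ f₁u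
  deriv_two : HasHoloDeriv U f₂ f₃ (fun p => -(w p * f₃ p))
  deriv_three : HasHoloDeriv U f₃ f₄ (fun p => -(c p * f₃ p + w p * f₄ p))
  deriv_w : HasHoloDeriv U w c wu
  deriv_wu : HasHoloDeriv U wu (fun p => c p * (x p + star (x p))) wuu
  deriv_c : ∀ p ∈ U, HasCoordDeriv c p ![0, 0, c p * (x p + star (x p)), 0]
  deriv_x : ∀ p ∈ U, HasCoordDeriv x p ![0, 0, x p * (x p + star (x p)), 0]
  f₃_ne : ∀ p ∈ U, f₃ p ≠ 0
  c_ne : ∀ p ∈ U, c p ≠ 0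
  x_ne : ∀ p ∈ U, x p ≠ 0
  c_ne_add : ∀ p ∈ U, c p ≠ x p + star (x p)
  ratio : ∀ p ∈ U, 4 * f₄ p * f₂ p = ((c p - star (x p)) / x p + 5) * f₃ p ^ 2

namespace AffineProfile

variable {U : Set Event} {f : ℂ → ℝ → ℂ} {f₁ f₂ f₃ f₄ fu f₁u w c wu wuu x : Event → ℂ}
  {e : Fin 4 → CField} {p : Event}
  (hU : IsOpen U) (he : IsNormalizedTetrad f U e)
  (S : AffineProfile U f f₁ f₂ f₃ f₄ fu f₁u w c wu wuu x)

include hU he S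

theorem spin_sq (hp : p ∈ U) : star (f₂ p) = 2 * spin e p ^ 2 ∧ spin e p ≠ 0 ∧ f₂ p ≠ 0 := by
  have h := he.psi4_eq p hp
  rw [psi4_eq_div hU he S.deriv_zero S.deriv_one hp] at h
  have h0 : 2 * spin e p ^ 2 ≠ 0 := by
    intro h0; rw [h0] at h; simp at h
  have h1 := (div_eq_one_iff_eq h0).1 h
  refine ⟨h1, fun h => h0 (by simp [h]), fun h => h0 ?_⟩
  rw [← h1, h]; simp

theorem hasLogDeriv_f₂ (hp : p ∈ U) :
    HasLogDeriv f₂ p ![f₃ p / f₂ p, 0, -(w p * (f₃ p / f₂ p)), 0] :=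
  (HasLogDeriv.of_hasCoordDeriv (S.deriv_two p hp) (S.spin_sq hU he hp).2.2).of_eq
    (by ext i; fin_cases i <;> simp; ring)

theorem hasLogDeriv_spin (hp : p ∈ U) : HasLogDeriv (spin e) p
    ![0, star (f₃ p / f₂ p) / 2, -(star (w p) * star (f₃ p / f₂ p)) / 2, 0] := by
  have h : HasLogDeriv (fun q => spin e q * spin e q) p _ :=
    ((S.hasLogDeriv_f₂ hU he hp).conj.const_mul (1 / 2)).congr_on hU hp fun q hq => by
      rw [(S.spin_sq hU he hq).1]; ring
  refine (HasLogDeriv.of_mul_self (he.smoothOn_spin.hasCoordDeriv hU hp).diff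
    (S.spin_sq hU he hp).2.1 h).of_eq ?_
  ext i; fin_cases i <;> simp [conjCoord]

theorem hasLogDeriv_boost (hp : p ∈ U) : HasLogDeriv (boost e) p
    ![f₃ p / f₂ p / 4, star (f₃ p / f₂ p) / 4,
      -(w p * (f₃ p / f₂ p) + star (w p) * star (f₃ p / f₂ p)) / 4, 0] := by
  have h1 := S.hasLogDeriv_spin hU he hp
  have h : HasLogDeriv (fun q => boost e q * boost e q) p _ :=
    (h1.mul h1.conj).congr_on hU hp fun q hq => by
      obtain ⟨hP, hR, -⟩ := he.components hq
      rw [spin, star_mul', hR]; linear_combination (-boost e q * boost e q) * hP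
  refine (HasLogDeriv.of_mul_self (he.smoothOn_boost.hasCoordDeriv hU hp).diff
    (he.components hp).2.2.1 h).of_eq ?_
  ext i; fin_cases i <;> simp [conjCoord] <;> ring

omit S hU in
theorem star_phase (hp : p ∈ U) : star (phase e p) = boost e p / spin e p := by
  obtain ⟨hP, -, hR, -⟩ := he.components hp
  have hP0 : phase e p ≠ 0 := left_ne_zero_of_mul_eq_one hP
  rw [eq_inv_of_mul_eq_one_right hP, spin]; field_simp

omit S in
-- The right side is `-(ω₁₂ + ω₃₄)`. Thus `α` and `γ` are half the derivatives of `log E` along `δ*`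
-- and `Δ`.
theorem along_spin (hp : p ∈ U) (X : CField) : along X (spin e) p / spin e p =
    star (phase e p) * along X (phase e) p + along X (boost e) p / boost e p := by
  obtain ⟨hP, -, hR, -⟩ := he.components hp
  have hP0 : phase e p ≠ 0 := left_ne_zero_of_mul_eq_one hP
  have : along X (spin e) p =
      boost e p * along X (phase e) p + phase e p * along X (boost e) p :=
    along_mul (he.smoothOn_boost.hasCoordDeriv hU hp) (he.smoothOn_phase.hasCoordDeriv hU hp) X
  rw [this, eq_inv_of_mul_eq_one_right hP, spin]; field_simp

/-- Since `γ = 0`, `Δ` annihilates `E`, hence also `f̄''`. As `∂_u f'' = -w f'''` and `f''' ≠ 0`,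
this determines the velocity. -/
theorem velocity_eq (hp : p ∈ U) : velocity e p = w p := by
  obtain ⟨-, -, hR, -, -, ⟨h20, h21, h22⟩, -⟩ := he.components hp
  obtain ⟨-, hE, h2⟩ := S.spin_sq hU he hp
  have h3 := S.f₃_ne p hp
  have h := he.gamma_eq p hp
  rw [gamma, connForm_zero_one hU he S.deriv_zero hp, connForm_two_three hU he S.deriv_zero hp] at h
  have h' : along (e 2) (spin e) p / spin e p = 0 := by
    rw [along_spin hU he hp]; linear_combination 2 * h
  rw [(S.hasLogDeriv_spin hU he hp).along] at h'
  have h2' := star_ne_zero.2 h2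
  simp [-star_def, -RCLike.star_def, Fin.sum_univ_four, h21, h22, hE, star_div₀] at h'
  field_simp at h'
  have h4 : (star (velocity e p) - star (w p)) * star (f₃ p) = 0 :=
    (mul_eq_zero.1 (by linear_combination h' : spin e p * _ = 0)).resolve_left hE
  have h5 := (mul_eq_zero.1 h4).resolve_right (star_ne_zero.2 h3)
  exact star_injective (sub_eq_zero.1 h5)

omit S hU in
theorem along_zero (hp : p ∈ U) {φ : Event → ℂ} {d : Fin 4 → ℂ} (h : HasCoordDeriv φ p d)
    (h3 : d 3 = 0) : along (e 0) φ p = spin e p / boost e p * d 0 := by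
  obtain ⟨-, -, hR, h0, -⟩ := he.components hp
  rw [h.along, Fin.sum_univ_four, h0, h3, spin, mul_div_cancel_left₀ _ hR]
  simp

omit S hU in
theorem along_one (hp : p ∈ U) {φ : Event → ℂ} {d : Fin 4 → ℂ} (h : HasCoordDeriv φ p d)
    (h3 : d 3 = 0) : along (e 1) φ p = boost e p / spin e p * d 1 := by
  obtain ⟨-, -, hR, -, h0, -⟩ := he.components hp
  rw [h.along, Fin.sum_univ_four, h0, h3, ← star_phase he hp]
  simp

theorem along_two (hp : p ∈ U) {φ : Event → ℂ} {d : Fin 4 → ℂ} (h : HasCoordDeriv φ p d)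
    (h3 : d 3 = 0) :
    along (e 2) φ p = (w p * d 0 + star (w p) * d 1 + d 2) / boost e p := by
  obtain ⟨-, -, hR, -, -, ⟨h20, h21, h22⟩, -⟩ := he.components hp
  rw [h.along, Fin.sum_univ_four, h3, h20, h21, h22, S.velocity_eq hU he hp]
  ring

theorem alpha_eq (hp : p ∈ U) :
    alpha f e p = 1 / 4 * (boost e p * star (f₃ p) * (star (f₂ p))⁻¹ * (spin e p)⁻¹) := by
  obtain ⟨-, -, hR, -⟩ := he.components hp
  obtain ⟨-, hE, h2⟩ := S.spin_sq hU he hp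
  rw [alpha, connForm_zero_one hU he S.deriv_zero hp, connForm_two_three hU he S.deriv_zero hp]
  have h := along_spin hU he hp (e 1)
  rw [along_one he hp (S.hasLogDeriv_spin hU he hp) (by simp)] at h
  have h2' := star_ne_zero.2 h2
  simp [-star_def, -RCLike.star_def, star_div₀] at h
  field_simp at h ⊢
  linear_combination -2 * h

theorem mu_eq (hp : p ∈ U) : mu f e p = c p * (boost e p)⁻¹ := by
  obtain ⟨-, -, hR, h0, -⟩ := he.components hp
  obtain ⟨-, hE, h2⟩ := S.spin_sq hU he hp
  have hw := (S.deriv_w p hp).congr_on hU hp fun q hq => S.velocity_eq hU he hq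
  rw [mu, connForm_one_two hU he S.deriv_zero hp, along_zero he hp hw (by simp), h0]
  simp
  field_simp

theorem nu_eq (hp : p ∈ U) : nu f e p =
    (wu p + w p * c p + 1 / 2 * star (f₁ p)) * ((spin e p)⁻¹ * (boost e p)⁻¹) := by
  obtain ⟨-, -, hR, -, -, ⟨h20, h21, h22⟩, -⟩ := he.components hp
  obtain ⟨-, hE, h2⟩ := S.spin_sq hU he hp
  have hw := (S.deriv_w p hp).congr_on hU hp fun q hq => S.velocity_eq hU he hq
  rw [nu, connForm_one_two hU he S.deriv_zero hp, S.along_two hU he hp hw (by simp), h22]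
  simp
  field_simp
  ring

end AffineProfile

/-! ### Functional dependence of `α`, `μ` and `ν` -/

/-- Without `dv`-components, the wedge product is the determinant of the coefficients times `dζ ∧
dζ̄ ∧ du`. -/
theorem wedge3_eq_zero_iff {a b c : Event → ℂ} {p : Event} {da db dc : Fin 4 → ℂ}
    (ha : HasCoordDeriv a p da) (hb : HasCoordDeriv b p db) (hc : HasCoordDeriv c p dc)
    (ha3 : da 3 = 0) (hb3 : db 3 = 0) (hc3 : dc 3 = 0) :
    (∀ x y z : Event, wedge3 a b c p x y z = 0) ↔
      Matrix.det !![da 0, da 1, da 2; db 0, db 1, db 2; dc 0, dc 1, dc 2] = 0 := by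
  have k (x y z : Event) : wedge3 a b c p x y z =
      Matrix.det !![da 0, da 1, da 2; db 0, db 1, db 2; dc 0, dc 1, dc 2] *
      Matrix.det !![x.1, y.1, z.1; star x.1, star y.1, star z.1;
        (x.2.1 : ℂ), (y.2.1 : ℂ), (z.2.1 : ℂ)] := by
    simp only [wedge3, fderiv_eq_coordDeriv, ha.eq, hb.eq, hc.eq, ha3, hb3, hc3]
    rw [← Matrix.det_mul]
    congr 1
    ext i j
    fin_cases i <;> fin_cases j <;> simp [Matrix.mul_apply, Fin.sum_univ_three]
  refine ⟨fun h => ?_, fun h x y z => by rw [k, h, zero_mul]⟩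
  have h1 := h (1, 0, 0) (I, 0, 0) (0, 1, 0)
  rw [k] at h1
  -- On these three vectors `dζ ∧ dζ̄ ∧ du` takes the value `-2i`.
  refine (mul_eq_zero.1 h1).resolve_right ?_
  rw [Matrix.det_fin_three]
  simp only [Matrix.of_apply, Matrix.cons_val', Matrix.cons_val_zero, Matrix.cons_val_one,
    Matrix.cons_val]
  simp
  intro h2
  have := congrArg Complex.im h2
  norm_num at this

namespace AffineProfile

variable {U : Set Event} {f : ℂ → ℝ → ℂ} {f₁ f₂ f₃ f₄ fu f₁u w c wu wuu x : Event → ℂ}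
  {e : Fin 4 → CField} {p : Event}

/-- The quantity whose vanishing expresses the functional dependence of `α`, `μ` and `ν`. -/
def defect (f₁ f₂ f₃ f₁u w c wu wuu x : Event → ℂ) (p : Event) : ℂ :=
  wuu p + wu p * c p + w p * (c p * (x p + star (x p))) + star (f₁u p) / 2
    + (w p + 4 * x p * f₂ p / f₃ p) * (c p * (x p + star (x p)) + c p ^ 2)
    + (star (w p) + 4 * star (x p) * star (f₂ p) / star (f₃ p)) * (star (f₂ p) / 2)
    - (x p + 3 * star (x p)) * (wu p + w p * c p + star (f₁ p) / 2)

variable (hU : IsOpen U) (he : IsNormalizedTetrad f U e)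
  (S : AffineProfile U f f₁ f₂ f₃ f₄ fu f₁u w c wu wuu x)

include hU he S

theorem f₄_eq (hp : p ∈ U) :
    f₄ p = ((c p - star (x p)) / x p + 5) / 4 * (f₃ p / f₂ p) * f₃ p := by
  have h2 := (S.spin_sq hU he hp).2.2
  have h := S.ratio p hp
  field_simp at h ⊢
  linear_combination h

theorem hasLogDeriv_f₃ (hp : p ∈ U) : HasLogDeriv f₃ p
    ![((c p - star (x p)) / x p + 5) / 4 * (f₃ p / f₂ p), 0,
      -(c p + w p * (((c p - star (x p)) / x p + 5) / 4 * (f₃ p / f₂ p))), 0] := by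
  have h3 := S.f₃_ne p hp
  refine (HasLogDeriv.of_hasCoordDeriv (S.deriv_three p hp) h3).of_eq ?_
  have h4 := S.f₄_eq hU he hp
  ext i; fin_cases i <;> simp [-star_def, -RCLike.star_def, h4] <;> field_simp

/-- The constants 4 and 5 in the field `ratio` of `AffineProfile` are the ones that make the
`∂_ζ̄`-component a quarter of the conjugate of `((c - x̄)/x) f'''/f''`, whence `A* = (c - x̄)/x`. -/
theorem hasLogDeriv_alpha (hp : p ∈ U) : HasLogDeriv (alpha f e) p
    ![f₃ p / f₂ p / 4, star ((c p - star (x p)) / x p) / 4 * star (f₃ p / f₂ p),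
      -(w p * (f₃ p / f₂ p / 4)) - star (w p) *
        (star ((c p - star (x p)) / x p) / 4 * star (f₃ p / f₂ p)) - star (c p), 0] := by
  obtain ⟨-, hE, h2⟩ := S.spin_sq hU he hp
  refine ((((((S.hasLogDeriv_boost hU he hp).mul (S.hasLogDeriv_f₃ hU he hp).conj).mul
    ((S.hasLogDeriv_f₂ hU he hp).conj.inv (star_ne_zero.2 h2))).mul
    ((S.hasLogDeriv_spin hU he hp).inv hE)).const_mul (1 / 4)).congr_on hU hp
    fun q hq => S.alpha_eq hU he hq).of_eq ?_
  ext i; fin_cases i <;> simp [conjCoord] <;> ring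

omit hU he in
theorem hasLogDeriv_c (hp : p ∈ U) : HasLogDeriv c p ![0, 0, x p + star (x p), 0] :=
  (S.deriv_c p hp).of_eq (by ext i; fin_cases i <;> simp)

omit hU he in
theorem hasLogDeriv_x (hp : p ∈ U) : HasLogDeriv x p ![0, 0, x p + star (x p), 0] :=
  (S.deriv_x p hp).of_eq (by ext i; fin_cases i <;> simp)

theorem hasLogDeriv_mu (hp : p ∈ U) : HasLogDeriv (mu f e) p
    ![-(f₃ p / f₂ p / 4), -(star (f₃ p / f₂ p) / 4),
      x p + star (x p) + (w p * (f₃ p / f₂ p) + star (w p) * star (f₃ p / f₂ p)) / 4, 0] := by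
  refine (((S.hasLogDeriv_c hp).mul ((S.hasLogDeriv_boost hU he hp).inv
    (he.components hp).2.2.1)).congr_on hU hp fun q hq => S.mu_eq hU he hq).of_eq ?_
  ext i; fin_cases i <;> simp; ring

omit hU he in
theorem hasCoordDeriv_acceleration (hp : p ∈ U) :
    HasCoordDeriv (fun p => wu p + w p * c p + 1 / 2 * star (f₁ p)) p
    ![c p * (x p + star (x p)) + c p ^ 2, star (f₂ p) / 2,
      wuu p + wu p * c p + w p * (c p * (x p + star (x p))) + star (f₁u p) / 2, 0] := by
  refine (((S.deriv_wu p hp).add ((S.deriv_w p hp).mul (S.deriv_c p hp))).add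
    ((S.deriv_one p hp).conj.const_mul (1 / 2))).of_eq ?_
  ext i; fin_cases i <;> simp [conjCoord] <;> ring

theorem hasLogDeriv_weight (hp : p ∈ U) :
    HasLogDeriv (fun p => (spin e p)⁻¹ * (boost e p)⁻¹) p
    ![-(f₃ p / f₂ p / 4), -(3 / 4 * star (f₃ p / f₂ p)),
      w p * (f₃ p / f₂ p) / 4 + star (w p) * (3 / 4 * star (f₃ p / f₂ p)), 0] := by
  refine (((S.hasLogDeriv_spin hU he hp).inv (S.spin_sq hU he hp).2.1).mul
    ((S.hasLogDeriv_boost hU he hp).inv (he.components hp).2.2.1)).of_eq ?_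
  ext i; fin_cases i <;> simp <;> ring

theorem alpha_ne (hp : p ∈ U) : alpha f e p ≠ 0 := by
  obtain ⟨-, hE, h2⟩ := S.spin_sq hU he hp
  have h3 := S.f₃_ne p hp
  have hR := (he.components hp).2.2.1
  rw [S.alpha_eq hU he hp]
  simpa [-star_def, -RCLike.star_def] using ⟨⟨⟨hR, h3⟩, h2⟩, hE⟩

theorem mu_ne (hp : p ∈ U) : mu f e p ≠ 0 := by
  rw [S.mu_eq hU he hp]
  exact mul_ne_zero (S.c_ne p hp) (inv_ne_zero (he.components hp).2.2.1)

/-- The field `V = ∂_u + (w + 4x f''/f''') ∂_ζ + (w̄ + 4x̄ f̄''/f̄''') ∂_ζ̄` annihilates `α` and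
`μ`, and `V log(1/(E R)) = -(x + 3x̄)`. Hence `defect`, which is `VN - (x + 3x̄) N` for `N = E R ν`,
equals `E R Vν`. -/
theorem wedge3_iff (hp : p ∈ U) :
    (∀ X Y Z : Event, wedge3 (alpha f e) (mu f e) (nu f e) p X Y Z = 0) ↔
      defect f₁ f₂ f₃ f₁u w c wu wuu x p = 0 := by
  obtain ⟨-, hE, h2⟩ := S.spin_sq hU he hp
  have h3 := S.f₃_ne p hp
  have hR := (he.components hp).2.2.1
  have hx := S.x_ne p hp
  have hν := ((S.hasCoordDeriv_acceleration hp).mul (S.hasLogDeriv_weight hU he hp)).congr_on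
    hU hp fun q hq => S.nu_eq hU he hq
  have h2' := star_ne_zero.2 h2
  have h3' := star_ne_zero.2 h3
  have hx' := star_ne_zero.2 hx
  have hα := S.alpha_ne hU he hp
  have hμ := S.mu_ne hU he hp
  rw [wedge3_eq_zero_iff (S.hasLogDeriv_alpha hU he hp) (S.hasLogDeriv_mu hU he hp) hν
    (by simp) (by simp) (by simp)]
  have hc : star (c p) - x p - star (x p) ≠ 0 := fun h => S.c_ne_add p hp <| by
    apply star_injective
    rw [star_add, star_star]; linear_combination h
  rw [Matrix.det_fin_three]
  simp only [Matrix.of_apply, Matrix.cons_val', Matrix.cons_val_zero, Matrix.cons_val_one,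
    Matrix.cons_val]
  -- The factors before `defect` come from the minor of `dα ∧ dμ` in `dζ ∧ dζ̄`. This minor is
  -- non-zero because `c ≠ x + x̄`, that is, `A ≠ 1`.
  have key : ∀ D, D = alpha f e p * mu f e p * ((spin e p)⁻¹ * (boost e p)⁻¹) *
      ((star (c p) - x p - star (x p)) / star (x p)) * (f₃ p / f₂ p) * (star (f₃ p) / star (f₂ p)) / 16 *
      defect f₁ f₂ f₃ f₁u w c wu wuu x p →
      (D = 0 ↔ defect f₁ f₂ f₃ f₁u w c wu wuu x p = 0) := by
    rintro D rfl
    simp [-star_def, -RCLike.star_def, hα, hμ, hE, hR, hc, h2, h3, hx]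
  refine key _ ?_
  rw [defect]
  simp only [star_div₀, star_sub, star_star]
  field_simp
  ring

end AffineProfile

/-! ### The invariants `A`, `X̃`, `ν̃` and `Υ̃` -/

namespace AffineProfile

variable {U : Set Event} {f : ℂ → ℝ → ℂ} {f₁ f₂ f₃ f₄ fu f₁u w c wu wuu x : Event → ℂ}
  {e : Fin 4 → CField} {p : Event}
  (hU : IsOpen U) (he : IsNormalizedTetrad f U e)
  (S : AffineProfile U f f₁ f₂ f₃ f₄ fu f₁u w c wu wuu x)

include hU he S

omit hU he in
theorem one_sub_ratio_ne (hp : p ∈ U) : 1 - (c p - star (x p)) / x p ≠ 0 := by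
  have hx := S.x_ne p hp
  intro h
  refine S.c_ne_add p hp ?_
  field_simp at h
  linear_combination -h

theorem invA_eq (hp : p ∈ U) : invA f e p = star ((c p - star (x p)) / x p) := by
  obtain ⟨-, hE, h2⟩ := S.spin_sq hU he hp
  have h3 := star_ne_zero.2 (S.f₃_ne p hp)
  have h2' := star_ne_zero.2 h2
  have hα := S.alpha_ne hU he hp
  have hR := (he.components hp).2.2.1
  rw [invA, along_one he hp (S.hasLogDeriv_alpha hU he hp) (by simp), sq, ← mul_assoc,
    div_eq_iff (mul_ne_zero hα hα)]
  simp only [Matrix.cons_val_one, Matrix.cons_val_zero]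
  rw [S.alpha_eq hU he hp]
  generalize (c p - star (x p)) / x p = a
  rw [star_div₀]
  field_simp

/-- In `R Δ log M*` the terms with `w` cancel and `x + x̄ - c` is left, which is `x (1 - A*)`. -/
theorem tildeX_eq (hp : p ∈ U) : tildeX f e p = x p * (boost e p)⁻¹ := by
  have hx := S.x_ne p hp
  have hR := (he.components hp).2.2.1
  have hM : star (invM f e p) ≠ 0 :=
    star_ne_zero.2 (mul_ne_zero (S.alpha_ne hU he hp) (S.mu_ne hU he hp))
  have h : HasLogDeriv (fun q => star (invM f e q)) p _ :=
    ((S.hasLogDeriv_alpha hU he hp).mul (S.hasLogDeriv_mu hU he hp)).conj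
  have h1 := S.one_sub_ratio_ne hp
  rw [tildeX, S.invA_eq hU he hp, star_star, along_two hU he S hp h (by simp [conjCoord]),
    ← mul_left_inj' h1, div_mul_cancel₀ _ h1]
  simp only [conjCoord, Matrix.cons_val_zero, Matrix.cons_val_one, Matrix.cons_val, star_add,
    star_sub, star_neg, star_mul', star_div₀, star_star]
  simp only [star_ofNat]
  field_simp
  ring

theorem tildeNu_eq (hp : p ∈ U) : tildeNu f e p = ((spin e p)⁻¹ * (boost e p)⁻¹) *
    (wu p + w p * c p + 1 / 2 * star (f₁ p) +
      4 * (x p * (f₂ p * (f₃ p)⁻¹) * (2 * star (x p) + c p))) := by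
  obtain ⟨-, hE, h2⟩ := S.spin_sq hU he hp
  have h3 := S.f₃_ne p hp
  have hx := S.x_ne p hp
  obtain ⟨hP, hsR, hR, -⟩ := he.components hp
  -- From `E Ē = R²`, as `|P| = 1` and `R` is real.
  have hsE : star (spin e p) = boost e p ^ 2 / spin e p := by
    rw [spin, star_mul', hsR, star_phase he hp, spin]; field_simp
  have hsα : star (alpha f e p) = spin e p * f₃ p / (4 * boost e p * f₂ p) := by
    rw [S.alpha_eq hU he hp]
    simp only [star_mul', star_inv₀, star_star, hsR, hsE, star_div₀, star_one, star_ofNat]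
    field_simp
  rw [tildeNu, S.nu_eq hU he hp, S.tildeX_eq hU he hp, S.mu_eq hU he hp, S.invA_eq hU he hp, hsα]
  simp only [star_mul', star_inv₀, star_star, hsR]
  field_simp
  ring

/-- The quotient `ν̃/X̃*` is `(N + 4x (f''/f''') (2x̄ + c)) / (E x̄)`. Its `Δ`-derivative supplies
the `Δ`-part of `Vν`, and the remaining terms of `Υ̃` supply the rest, so that `Υ̃` is `defect`
divided by `E R x̄`. -/
theorem tildeUpsilon_iff (hp : p ∈ U) :
    tildeUpsilon f e p = 0 ↔ defect f₁ f₂ f₃ f₁u w c wu wuu x p = 0 := by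
  obtain ⟨-, hE, h2⟩ := S.spin_sq hU he hp
  have h3 := S.f₃_ne p hp
  have hx := S.x_ne p hp
  have h2' := star_ne_zero.2 h2
  have h3' := star_ne_zero.2 h3
  have hx' := star_ne_zero.2 hx
  obtain ⟨hP, hsR, hR, -⟩ := he.components hp
  have hsE : star (spin e p) = boost e p ^ 2 / spin e p := by
    rw [spin, star_mul', hsR, star_phase he hp, spin]; field_simp
  have hsα : star (alpha f e p) = spin e p * f₃ p / (4 * boost e p * f₂ p) := by
    rw [S.alpha_eq hU he hp]
    simp only [star_mul', star_inv₀, star_star, hsR, hsE, star_div₀, star_one, star_ofNat]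
    field_simp
  have hxb := (S.hasLogDeriv_x hp).conj
  have hsum : HasLogDeriv (fun q => 2 * star (x q) + c q) p ![0, 0, x p + star (x p), 0] :=
    ((hxb.const_mul 2).add (S.hasLogDeriv_c hp)).of_eq (by
      ext i; fin_cases i <;> simp [conjCoord]; ring)
  have hcorr : HasLogDeriv (fun q => x q * (f₂ q * (f₃ q)⁻¹) * (2 * star (x q) + c q)) p _ :=
    ((S.hasLogDeriv_x hp).mul ((S.hasLogDeriv_f₂ hU he hp).mul
      ((S.hasLogDeriv_f₃ hU he hp).inv h3))).mul hsum
  have hN := (S.hasCoordDeriv_acceleration hp).add (HasLogDeriv.const_mul 4 hcorr)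
  have hq : HasLogDeriv (fun q => (spin e q)⁻¹ * (star (x q))⁻¹) p _ :=
    ((S.hasLogDeriv_spin hU he hp).inv hE).mul (hxb.inv hx')
  have hν := (HasCoordDeriv.mul hq hN).congr_on hU hp
    (ψ := fun q => tildeNu f e q / star (tildeX f e q)) fun q hq => by
      obtain ⟨-, hsR, hR, -⟩ := he.components hq
      have := star_ne_zero.2 (S.x_ne q hq)
      have := (S.spin_sq hU he hq).2.1
      rw [S.tildeNu_eq hU he hq, S.tildeX_eq hU he hq, star_mul', star_inv₀, hsR]
      field_simp
  have him (z : ℂ) : 4 * I * (z.im : ℂ) = 2 * (z - star z) := by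
    have := sub_conj z
    rw [star_def, this]; push_cast; ring
  have hX : 4 * I * tildeX f e p * ((tildeX f e p).im : ℂ) =
      2 * (x p * (boost e p)⁻¹) * (x p - star (x p)) * (boost e p)⁻¹ := by
    rw [mul_right_comm, him, S.tildeX_eq hU he hp, star_mul', star_inv₀, hsR]; ring
  have key : tildeUpsilon f e p = ((spin e p)⁻¹ * (boost e p)⁻¹) * (star (x p))⁻¹ *
      defect f₁ f₂ f₃ f₁u w c wu wuu x p := by
    rw [tildeUpsilon, hX, hsα, S.tildeNu_eq hU he hp, S.alpha_eq hU he hp,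
      S.along_two hU he hp hν (by simp [conjCoord]), defect, (S.spin_sq hU he hp).1]
    simp only [conjCoord, Matrix.cons_val_zero, Matrix.cons_val_one, Matrix.cons_val, star_add,
      star_div₀, star_star, star_zero]
    rw [(S.spin_sq hU he hp).1]
    field_simp
    ring
  rw [key]
  simp [-star_def, -RCLike.star_def, hE, hR, hx]

end AffineProfile

/-! ### The families of solutions in a common form -/

/-- A rotation `t` of the `ζ`-plane depending on `u ∈ J`, with angular velocity `-iτ`, for which
`τ` and the real function `ρ` satisfy the equations fulfilled by multiples of `1 / u`. -/
structure IsClock (J : Set ℝ) (t τ ρ : ℝ → ℂ) : Prop where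
  deriv_t : ∀ u ∈ J, HasDerivAt t (τ u * t u) u
  deriv_τ : ∀ u ∈ J, HasDerivAt τ (ρ u * τ u) u
  deriv_ρ : ∀ u ∈ J, HasDerivAt ρ (ρ u * ρ u) u
  star_τ : ∀ u ∈ J, star (τ u) = -τ u
  star_ρ : ∀ u ∈ J, star (ρ u) = ρ u
  t_ne : ∀ u ∈ J, t u ≠ 0
  add_ne : ∀ u ∈ J, ρ u + τ u ≠ 0

/-- A holomorphic function with the derivatives `h₁, h₂, h₃, h₄`, for which `h₂ / h₃` is the affine
function `a z + b`. -/
structure IsRatioAffine (Z : Set ℂ) (h h₁ h₂ h₃ h₄ : ℂ → ℂ) (a b : ℂ) : Prop where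
  deriv_zero : ∀ z ∈ Z, HasDerivAt h (h₁ z) z
  deriv_one : ∀ z ∈ Z, HasDerivAt h₁ (h₂ z) z
  deriv_two : ∀ z ∈ Z, HasDerivAt h₂ (h₃ z) z
  deriv_three : ∀ z ∈ Z, HasDerivAt h₃ (h₄ z) z
  ratio : ∀ z ∈ Z, h₂ z = (a * z + b) * h₃ z
  ratio_succ : ∀ z ∈ Z, (a * z + b) * h₄ z = (1 - a) * h₃ z
  ratio_pred : ∀ z ∈ Z, (a * z + b) * h₂ z = (1 + a) * h₁ z
  h₃_ne : ∀ z ∈ Z, h₃ z ≠ 0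
  one_add_ne : 1 + 2 * a ≠ 0

section Family

variable {J : Set ℝ} {t τ ρ s : ℝ → ℂ} {Z : Set ℂ} {h h₁ h₂ h₃ h₄ : ℂ → ℂ} {a b ε : ℂ}

theorem hasDerivAt_weight (hC : IsClock J t τ ρ)
    (hs : ∀ u ∈ J, HasDerivAt s (ε * ρ u * s u) u) (j : ℕ) {u : ℝ} (hu : u ∈ J) :
    HasDerivAt (fun u => s u * t u ^ j) ((ε * ρ u + j * τ u) * (s u * t u ^ j)) u := by
  have := (hs u hu).mul ((hC.deriv_t u hu).pow j)
  refine this.congr_deriv ?_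
  rcases j with _ | j
  · simp
  · simp only [Nat.add_sub_cancel, Pi.pow_apply]; push_cast; ring

theorem hasCoordDeriv_z (hC : IsClock J t τ ρ) {p : Event} (hp : p.2.1 ∈ J) :
    HasCoordDeriv (fun q => t q.2.1 * q.1) p
      ![t p.2.1, 0, τ p.2.1 * (t p.2.1 * p.1), 0] := by
  refine ((HasCoordDeriv.of_u (hC.deriv_t _ hp)).mul HasCoordDeriv.zeta).of_eq ?_
  ext i; fin_cases i <;> simp; ring

theorem hasCoordDeriv_weight_mul (hC : IsClock J t τ ρ)
    (hs : ∀ u ∈ J, HasDerivAt s (ε * ρ u * s u) u) (j : ℕ) {p : Event} (hp : p.2.1 ∈ J)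
    {φ : ℂ → ℂ} {φ' : ℂ} (hφ : HasDerivAt φ φ' (t p.2.1 * p.1)) :
    HasCoordDeriv (fun q => s q.2.1 * t q.2.1 ^ j * φ (t q.2.1 * q.1)) p
      ![s p.2.1 * t p.2.1 ^ (j + 1) * φ', 0, s p.2.1 * t p.2.1 ^ j *
        ((ε * ρ p.2.1 + j * τ p.2.1) * φ (t p.2.1 * p.1)
          + τ p.2.1 * (t p.2.1 * p.1) * φ'), 0] := by
  refine ((HasCoordDeriv.of_u (hasDerivAt_weight hC hs j hp)).mul
    (HasCoordDeriv.comp_holo hφ (hasCoordDeriv_z hC hp))).of_eq ?_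
  ext i; fin_cases i <;> simp <;> ring

/-- The parameter `ε` is the weight of the prefactor: 2 for `u⁻²`, 0 when the factor is absent. By
`hε` the second choice requires `a = 0`, the exponential case, so that `c` does not depend on `ε`.
-/
theorem exists_affineProfile {U : Set Event} (hU : IsOpen U) {f : ℂ → ℝ → ℂ} {g : ℝ → ℂ}
    (hC : IsClock J t τ ρ) (hH : IsRatioAffine Z h h₁ h₂ h₃ h₄ a b)
    (hs : ∀ u ∈ J, HasDerivAt s (ε * ρ u * s u) u) (hs0 : ∀ u ∈ J, s u ≠ 0)
    (hε : a * ε = a * 2)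
    (hg : ∀ p ∈ U, DifferentiableAt ℝ g p.2.1)
    (hJ : ∀ p ∈ U, p.2.1 ∈ J ∧ t p.2.1 * p.1 ∈ Z)
    (hc : ∀ u ∈ J, 2 * a * ρ u + (1 + 2 * a) * τ u ≠ 0)
    (hf : ∀ p ∈ U, f p.1 p.2.1 = s p.2.1 * h (t p.2.1 * p.1)
      + s p.2.1 * g p.2.1 * (t p.2.1 * p.1)) :
    ∃ f₁ f₂ f₃ f₄ fu f₁u w c wu wuu x : Event → ℂ,
      AffineProfile U f f₁ f₂ f₃ f₄ fu f₁u w c wu wuu x ∧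
      (ε = 2 → ∀ p ∈ U, AffineProfile.defect f₁ f₂ f₃ f₁u w c wu wuu x p =
        star (s p.2.1 * t p.2.1 * deriv g p.2.1) / 2) := by
  let z (p : Event) : ℂ := t p.2.1 * p.1
  -- Here `f'' = s t² h₂(z)`, `f''' = s t³ h₃(z)` and `h₂ = (a z + b) h₃`. Solving `∂_u f'' + w f'''
  -- = 0` gives `w t = -((ερ + 2τ)(a z + b) + τ z)`. The functions `c` and `β` are its coefficients
  -- as an affine function of `ζ`.
  let c (u : ℝ) : ℂ := -(2 * a * ρ u + (1 + 2 * a) * τ u)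
  let β (u : ℝ) : ℂ := (ε * ρ u + 2 * τ u) * b * (t u)⁻¹
  let fu (p : Event) : ℂ := s p.2.1 * (ε * ρ p.2.1 * h (z p) + τ p.2.1 * z p * h₁ (z p)
    + (ε * ρ p.2.1 + τ p.2.1) * g p.2.1 * z p + deriv g p.2.1 * z p)
  let f₁ (p : Event) : ℂ := s p.2.1 * t p.2.1 * (h₁ (z p) + g p.2.1)
  let f₁u (p : Event) : ℂ := s p.2.1 * t p.2.1 * ((ε * ρ p.2.1 + τ p.2.1) * (h₁ (z p) + g p.2.1)
    + τ p.2.1 * z p * h₂ (z p) + deriv g p.2.1)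
  let f₂ (p : Event) : ℂ := s p.2.1 * t p.2.1 ^ 2 * h₂ (z p)
  let f₃ (p : Event) : ℂ := s p.2.1 * t p.2.1 ^ 3 * h₃ (z p)
  let f₄ (p : Event) : ℂ := s p.2.1 * t p.2.1 ^ 4 * h₄ (z p)
  let w (p : Event) : ℂ := c p.2.1 * p.1 - β p.2.1
  let wu (p : Event) : ℂ := ρ p.2.1 * c p.2.1 * p.1 - (ρ p.2.1 - τ p.2.1) * β p.2.1
  let wuu (p : Event) : ℂ := 2 * ρ p.2.1 ^ 2 * c p.2.1 * p.1
    - (ρ p.2.1 - τ p.2.1) * (2 * ρ p.2.1 - τ p.2.1) * β p.2.1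
  -- As `ρ` is real and `τ` imaginary, `x + x̄ = ρ`, which is the common logarithmic derivative of
  -- `c`, `ρ` and `τ`.
  let x (p : Event) : ℂ := 1 / 2 * (ρ p.2.1 + τ p.2.1)
  have hsx {p} (hp : p ∈ U) : star (x p) = 1 / 2 * (ρ p.2.1 - τ p.2.1) := by
    simp only [x, star_mul', star_add, hC.star_τ _ (hJ p hp).1, hC.star_ρ _ (hJ p hp).1,
      star_div₀, star_one, star_ofNat]
    ring
  have hxx {p} (hp : p ∈ U) : x p + star (x p) = ρ p.2.1 := by
    rw [hsx hp]; ring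
  have dc {u} (hu : u ∈ J) : HasDerivAt c (ρ u * c u) u :=
    ((((hC.deriv_ρ u hu).const_mul (2 * a)).add ((hC.deriv_τ u hu).const_mul (1 + 2 * a))).neg
      ).congr_deriv (by simp only [c]; ring)
  have dβ {u} (hu : u ∈ J) : HasDerivAt β ((ρ u - τ u) * β u) u :=
    (((((hC.deriv_ρ u hu).const_mul ε).add ((hC.deriv_τ u hu).const_mul 2)).mul_const b).mul
      ((hC.deriv_t u hu).inv (hC.t_ne u hu))).congr_deriv (by
        have := hC.t_ne u hu
        simp only [β, Pi.add_apply, Pi.inv_apply]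
        field_simp
        ring)
  have dg {p} (hp : p ∈ U) := (hg p hp).hasDerivAt
  have hwt {p} (hp : p ∈ U) : w p * t p.2.1 =
      -((ε * ρ p.2.1 + 2 * τ p.2.1) * (a * z p + b) + τ p.2.1 * z p) := by
    have := hC.t_ne _ (hJ p hp).1
    simp only [w, c, β, z]
    field_simp
    linear_combination ρ p.2.1 * p.1 * t p.2.1 * hε
  refine ⟨f₁, f₂, f₃, f₄, fu, f₁u, w, fun p => c p.2.1, wu, wuu, x, ?_, ?_⟩
  · constructor
    · intro p hp
      obtain ⟨hj, hz⟩ := hJ p hp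
      refine (((hasCoordDeriv_weight_mul hC hs 0 hj (hH.deriv_zero _ hz)).add
        (((HasCoordDeriv.of_u (hs _ hj)).mul (HasCoordDeriv.of_u (dg hp))).mul
          (hasCoordDeriv_z hC hj))).congr_on hU hp fun q hq => by
            rw [hf q hq]; ring).of_eq ?_
      ext i; fin_cases i <;> simp [f₁, fu, z] <;> ring
    · intro p hp
      obtain ⟨hj, hz⟩ := hJ p hp
      refine (((hasCoordDeriv_weight_mul hC hs 1 hj (hH.deriv_one _ hz)).add
        ((HasCoordDeriv.of_u (hasDerivAt_weight hC hs 1 hj)).mul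
          (HasCoordDeriv.of_u (dg hp)))).congr_on hU hp fun q hq => by
            simp only [f₁, z]; ring).of_eq ?_
      ext i; fin_cases i <;> simp [f₂, f₁u, z]; ring
    · intro p hp
      obtain ⟨hj, hz⟩ := hJ p hp
      refine (hasCoordDeriv_weight_mul hC hs 2 hj (hH.deriv_two _ hz)).of_eq ?_
      ext i; fin_cases i <;> simp [f₃]
      · exact Or.inl rfl
      · rw [hH.ratio _ hz]
        linear_combination s p.2.1 * t p.2.1 ^ 2 * h₃ (t p.2.1 * p.1) * hwt hp
    · intro p hp
      obtain ⟨hj, hz⟩ := hJ p hp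
      refine (hasCoordDeriv_weight_mul hC hs 3 hj (hH.deriv_three _ hz)).of_eq ?_
      ext i; fin_cases i <;> simp [f₃, f₄]
      · exact Or.inl rfl
      · linear_combination s p.2.1 * t p.2.1 ^ 3 * h₄ (t p.2.1 * p.1) * hwt hp
          - s p.2.1 * t p.2.1 ^ 3 * (ε * ρ p.2.1 + 2 * τ p.2.1) * hH.ratio_succ _ hz
          + s p.2.1 * t p.2.1 ^ 3 * h₃ (t p.2.1 * p.1) * ρ p.2.1 * hε
    · intro p hp
      obtain ⟨hj, hz⟩ := hJ p hp
      refine (((HasCoordDeriv.of_u (dc hj)).mul HasCoordDeriv.zeta).sub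
        (HasCoordDeriv.of_u (dβ hj))).of_eq ?_
      ext i; fin_cases i <;> simp [wu]; ring
    · intro p hp
      obtain ⟨hj, hz⟩ := hJ p hp
      refine ((((HasCoordDeriv.of_u (hC.deriv_ρ _ hj)).mul (HasCoordDeriv.of_u (dc hj))).mul
        HasCoordDeriv.zeta).sub (((HasCoordDeriv.of_u (hC.deriv_ρ _ hj)).sub
          (HasCoordDeriv.of_u (hC.deriv_τ _ hj))).mul (HasCoordDeriv.of_u (dβ hj)))).of_eq ?_
      simp only [hxx hp]
      ext i; fin_cases i <;> simp [wuu] <;> ring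
    · intro p hp
      rw [hxx hp]
      refine (HasCoordDeriv.of_u (dc (hJ p hp).1)).of_eq ?_
      rw [mul_comm]
    · intro p hp
      obtain ⟨hj, hz⟩ := hJ p hp
      rw [hxx hp]
      refine (((HasCoordDeriv.of_u (hC.deriv_ρ _ hj)).add
        (HasCoordDeriv.of_u (hC.deriv_τ _ hj))).const_mul (1 / 2)).of_eq ?_
      ext i; fin_cases i <;> simp [x]; ring
    · intro p hp
      obtain ⟨hj, hz⟩ := hJ p hp
      exact mul_ne_zero (mul_ne_zero (hs0 _ hj) (pow_ne_zero _ (hC.t_ne _ hj))) (hH.h₃_ne _ hz)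
    · exact fun p hp => neg_ne_zero.2 (hc _ (hJ p hp).1)
    · exact fun p hp => mul_ne_zero (by norm_num) (hC.add_ne _ (hJ p hp).1)
    · intro p hp heq
      rw [hxx hp] at heq
      refine mul_ne_zero hH.one_add_ne (hC.add_ne _ (hJ p hp).1) ?_
      linear_combination -heq
    · intro p hp
      obtain ⟨hj, hz⟩ := hJ p hp
      have hx0 := hC.add_ne _ hj
      -- This is `A*`, a constant for these waves.
      have hq : (c p.2.1 - star (x p)) / x p = -4 * a - 1 := by
        rw [hsx hp]
        simp only [x, c]
        field_simp
        ring
      rw [hq]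
      simp only [f₂, f₃, f₄, z]
      rw [hH.ratio _ hz]
      linear_combination 4 * s p.2.1 ^ 2 * t p.2.1 ^ 6 * h₃ (t p.2.1 * p.1) * hH.ratio_succ _ hz
  · rintro rfl p hp
    obtain ⟨hj, hz⟩ := hJ p hp
    have ht := hC.t_ne _ hj
    have h3 := hH.h₃_ne _ hz
    have hs' := hs0 _ hj
    have hr : f₂ p / f₃ p = (a * z p + b) / t p.2.1 := by
      simp only [f₂, f₃, z]
      rw [hH.ratio _ hz]
      field_simp
    -- The terms of `defect` containing `f̄'`, conjugated and doubled. For `ε = 2`, the coefficient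
    -- of `f''` reduces to `-τ z/t` and `x̄ + 3x` equals `2ρ + τ`, so everything but the term with
    -- `g'` cancels.
    have holo : f₁u p + (w p + 4 * x p * (f₂ p / f₃ p)) * f₂ p
        - (star (x p) + 3 * x p) * f₁ p = s p.2.1 * t p.2.1 * deriv g p.2.1 := by
      have hw : w p + 4 * x p * (f₂ p / f₃ p) = - τ p.2.1 * z p / t p.2.1 := by
        rw [hr, eq_div_iff ht, add_mul, hwt hp]
        simp only [x]
        field_simp
        ring
      rw [hw, hsx hp]
      simp only [x, f₁, f₂, f₁u]
      field_simp
      ring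
    have anti := congrArg star holo
    simp only [star_sub, star_add, star_mul', star_star, star_div₀, star_ofNat] at anti
    -- The part of `defect` that depends only on `w` and the ratio `f''/f'''` vanishes identically.
    have affine : wuu p + wu p * c p.2.1 + w p * (c p.2.1 * ρ p.2.1)
        + (w p + 4 * x p * (f₂ p / f₃ p)) * (c p.2.1 * ρ p.2.1 + c p.2.1 ^ 2)
        - (x p + 3 * star (x p)) * (wu p + w p * c p.2.1) = 0 := by
      rw [hr, hsx hp]
      simp only [x, wuu, wu, w, β, c, z]
      field_simp
      ring
    simp only [AffineProfile.defect]
    rw [hxx hp]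
    simp only [star_mul']
    linear_combination affine + anti / 2

end Family

theorem isClock_zB (k : ℝ) : IsClock {u : ℝ | 0 < u}
    (fun u => exp (-(I * k * (Real.log u : ℂ)))) (fun u => -(I * k * (u : ℂ)⁻¹))
    (fun u => -(u : ℂ)⁻¹) := by
  have inv {u : ℝ} (hu : 0 < u) : HasDerivAt (fun u : ℝ => (u : ℂ)⁻¹) (-((u : ℂ)⁻¹ * (u : ℂ)⁻¹)) u := by
    have h0 : (u : ℂ) ≠ 0 := by exact_mod_cast hu.ne'
    refine ((hasDerivAt_id u).ofReal_comp.inv h0).congr_deriv ?_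
    simp only [ofReal_one, id_eq]
    field_simp
  constructor
  · intro u hu
    refine (((Real.hasDerivAt_log (ne_of_gt hu)).ofReal_comp.const_mul (I * k)).neg.cexp).congr_deriv ?_
    simp only [Pi.neg_apply]
    push_cast
    ring
  · intro u hu
    exact ((inv hu).const_mul (I * k)).neg.congr_deriv (by ring)
  · intro u hu
    exact (inv hu).neg.congr_deriv (by ring)
  · intro u _
    simp
  · intro u _
    simp
  · exact fun u _ => exp_ne_zero _
  · intro u hu h
    have h0 : (u : ℂ) ≠ 0 := by exact_mod_cast (ne_of_gt hu)
    have h1 : 1 + I * (k : ℂ) = 0 := by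
      field_simp at h
      linear_combination -h
    simpa using congrArg Complex.re h1

theorem isClock_zC : IsClock Set.univ (fun u => exp (I * u)) (fun _ => I) (fun _ => 0) where
  deriv_t u _ := (((hasDerivAt_id u).ofReal_comp.const_mul I).cexp).congr_deriv (by
    simp; ring)
  deriv_τ u _ := by simpa using hasDerivAt_const u I
  deriv_ρ u _ := by simpa using hasDerivAt_const u (0 : ℂ)
  star_τ _ _ := by simp
  star_ρ _ _ := by simp
  t_ne _ _ := exp_ne_zero _
  add_ne _ _ := by simp

theorem isRatioAffine_exp {k : ℂ} (hk : k ≠ 0) : IsRatioAffine Set.univ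
    (fun z => exp (k * z)) (fun z => k * exp (k * z)) (fun z => k ^ 2 * exp (k * z))
    (fun z => k ^ 3 * exp (k * z)) (fun z => k ^ 4 * exp (k * z)) 0 k⁻¹ := by
  have d (z : ℂ) : HasDerivAt (fun z => exp (k * z)) (k * exp (k * z)) z :=
    (((hasDerivAt_id z).const_mul k).cexp).congr_deriv (by simp; ring)
  constructor
  · exact fun z _ => d z
  · exact fun z _ => ((d z).const_mul k).congr_deriv (by ring)
  · exact fun z _ => ((d z).const_mul (k ^ 2)).congr_deriv (by ring)
  · exact fun z _ => ((d z).const_mul (k ^ 3)).congr_deriv (by ring)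
  · intro z _; field_simp; ring
  · intro z _; field_simp; ring
  · intro z _; field_simp; ring
  · exact fun z _ => mul_ne_zero (pow_ne_zero _ hk) (exp_ne_zero _)
  · simp

theorem IsLogBranch.hasDerivAt {l : ℂ → ℂ} {W : Set ℂ} (hl : IsLogBranch l W) {w : ℂ}
    (hw : w ∈ W) : HasDerivAt l w⁻¹ w ∧ w ≠ 0 := by
  have h0 : w ≠ 0 := by rw [← hl.exp_eq w hw]; exact exp_ne_zero _
  have hW := hl.isOpen.mem_nhds hw
  have h1 := (hl.holo.differentiableAt hW).hasDerivAt
  have h2 : HasDerivAt (fun w => exp (l w)) 1 w :=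
    (hasDerivAt_id w).congr_of_eventuallyEq (Filter.eventually_of_mem hW hl.exp_eq)
  have h3 := h1.cexp.unique h2
  rw [hl.exp_eq w hw] at h3
  rw [eq_inv_of_mul_eq_one_right h3] at h1
  exact ⟨h1, h0⟩

/-- For a power `h = (kz)^n` one has `h''/h''' = z/(n - 2)`. The excluded exponents are those with
`h''' = 0`. -/
theorem isRatioAffine_cpow {k n : ℂ} (hk : k ≠ 0) (hn : n ≠ 0) (hn1 : n - 1 ≠ 0) (hn2 : n - 2 ≠ 0)
    {l : ℂ → ℂ} {W : Set ℂ} (hl : IsLogBranch l W) : IsRatioAffine {z | k * z ∈ W}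
    (fun z => exp (n * l (k * z))) (fun z => n * exp (n * l (k * z)) / z)
    (fun z => n * (n - 1) * exp (n * l (k * z)) / z ^ 2)
    (fun z => n * (n - 1) * (n - 2) * exp (n * l (k * z)) / z ^ 3)
    (fun z => n * (n - 1) * (n - 2) * (n - 3) * exp (n * l (k * z)) / z ^ 4) (n - 2)⁻¹ 0 := by
  have hz {z : ℂ} (h : k * z ∈ W) : z ≠ 0 := right_ne_zero_of_mul (hl.hasDerivAt h).2
  have d {z : ℂ} (h : k * z ∈ W) : HasDerivAt (fun z => exp (n * l (k * z)))
      (n * exp (n * l (k * z)) / z) z := by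
    have := hz h
    refine ((((hl.hasDerivAt h).1.comp z ((hasDerivAt_id z).const_mul k)).const_mul n).cexp).congr_deriv ?_
    simp
    field_simp
  constructor
  · exact fun z h => d h
  · intro z h
    have := hz h
    exact (((d h).const_mul n).div (hasDerivAt_id z) this).congr_deriv (by
      simp only [id]; field_simp)
  · intro z h
    have := hz h
    exact (((d h).const_mul (n * (n - 1))).div ((hasDerivAt_id z).pow 2)
      (pow_ne_zero _ this)).congr_deriv (by
        simp only [id, Pi.pow_apply]; field_simp; push_cast; ring)
  · intro z h
    have := hz h
    exact (((d h).const_mul (n * (n - 1) * (n - 2))).div ((hasDerivAt_id z).pow 3)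
      (pow_ne_zero _ this)).congr_deriv (by
        simp only [id, Pi.pow_apply]; field_simp; push_cast; ring)
  · intro z h
    have := hz h
    field_simp
    ring
  · intro z h
    have := hz h
    field_simp
    ring
  · intro z h
    have := hz h
    field_simp
    ring
  · intro z h
    have := hz h
    exact div_ne_zero (mul_ne_zero (mul_ne_zero (mul_ne_zero hn hn1) hn2) (exp_ne_zero _))
      (pow_ne_zero _ this)
  · have : 1 + 2 * (n - 2)⁻¹ = n / (n - 2) := by field_simp; ring
    rw [this]
    exact div_ne_zero hn hn2

/-! ### The equivalences for each family -/

section Equivalence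

variable {J : Set ℝ} {t τ ρ s : ℝ → ℂ} {Z : Set ℂ} {h h₁ h₂ h₃ h₄ : ℂ → ℂ} {a b : ℂ}
  {U : Set Event} {f : ℂ → ℝ → ℂ} {g : ℝ → ℂ} {e : Fin 4 → CField}

theorem wedge3_tfae (hU : IsOpen U) (he : IsNormalizedTetrad f U e)
    (hC : IsClock J t τ ρ) (hH : IsRatioAffine Z h h₁ h₂ h₃ h₄ a b)
    (hs : ∀ u ∈ J, HasDerivAt s (2 * ρ u * s u) u) (hs0 : ∀ u ∈ J, s u ≠ 0)
    (hg : ∀ p ∈ U, DifferentiableAt ℝ g p.2.1)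
    (hJ : ∀ p ∈ U, p.2.1 ∈ J ∧ t p.2.1 * p.1 ∈ Z)
    (hc : ∀ u ∈ J, 2 * a * ρ u + (1 + 2 * a) * τ u ≠ 0)
    (hf : ∀ p ∈ U, f p.1 p.2.1 = s p.2.1 * h (t p.2.1 * p.1)
      + s p.2.1 * g p.2.1 * (t p.2.1 * p.1)) :
    List.TFAE [
      ∀ p ∈ U, ∀ x y z : Event, wedge3 (alpha f e) (mu f e) (nu f e) p x y z = 0,
      ∀ p ∈ U, tildeUpsilon f e p = 0,
      ∀ p ∈ U, deriv g p.2.1 = 0] := by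
  obtain ⟨f₁, f₂, f₃, f₄, fu, f₁u, w, c, wu, wuu, x, S, hd⟩ :=
    exists_affineProfile hU hC hH hs hs0 rfl hg hJ hc hf
  have h12 : (∀ p ∈ U, ∀ x y z : Event, wedge3 (alpha f e) (mu f e) (nu f e) p x y z = 0) ↔
      ∀ p ∈ U, tildeUpsilon f e p = 0 :=
    forall₂_congr fun p hp => (S.wedge3_iff hU he hp).trans (S.tildeUpsilon_iff hU he hp).symm
  have h23 : (∀ p ∈ U, tildeUpsilon f e p = 0) ↔ ∀ p ∈ U, deriv g p.2.1 = 0 :=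
    forall₂_congr fun p hp => by
      rw [S.tildeUpsilon_iff hU he hp, hd rfl p hp]
      simp [-star_def, -RCLike.star_def, hs0 _ (hJ p hp).1, hC.t_ne _ (hJ p hp).1]
  tfae_have 1 ↔ 2 := h12
  tfae_have 2 ↔ 3 := h23
  tfae_finish

end Equivalence

theorem hasDerivAt_inv_sq {u : ℝ} (hu : 0 < u) :
    HasDerivAt (fun u : ℝ => ((u : ℂ) ^ 2)⁻¹) (2 * (-(u : ℂ)⁻¹) * ((u : ℂ) ^ 2)⁻¹) u := by
  have h0 : (u : ℂ) ≠ 0 := by exact_mod_cast hu.ne'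
  refine (((hasDerivAt_id u).ofReal_comp.pow 2).inv (pow_ne_zero _ h0)).congr_deriv ?_
  simp
  field_simp

theorem inv_sq_ne_zero {u : ℝ} (hu : 0 < u) : ((u : ℂ) ^ 2)⁻¹ ≠ 0 :=
  inv_ne_zero (pow_ne_zero _ (by exact_mod_cast hu.ne'))

theorem I_mul_ofReal_sub_ne {k : ℝ} {n : ℝ} (hn : n ≠ 0) : I * (k : ℂ) - n ≠ 0 := by
  intro h
  have := congrArg Complex.re h
  simp at this
  exact hn this

theorem IsBCPE13.tfae {U : Set Event} (hU : IsOpen U) {f : ℂ → ℝ → ℂ} {g : ℝ → ℂ}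
    (hg : ∀ p ∈ U, DifferentiableAt ℝ g p.2.1) {e : Fin 4 → CField}
    (he : IsNormalizedTetrad f U e) (H : IsBCPE13 U f g) :
    List.TFAE [
      ∀ p ∈ U, ∀ x y z : Event, wedge3 (alpha f e) (mu f e) (nu f e) p x y z = 0,
      ∀ p ∈ U, tildeUpsilon f e p = 0,
      ∀ p ∈ U, deriv g p.2.1 = 0] := by
  have n1 (k : ℝ) : I * (k : ℂ) - 1 ≠ 0 := by
    simpa using I_mul_ofReal_sub_ne (k := k) (n := 1) one_ne_zero
  have n2 (k : ℝ) : I * (k : ℂ) - 2 ≠ 0 := by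
    simpa using I_mul_ofReal_sub_ne (k := k) (n := 2) two_ne_zero
  rcases H with ⟨k₀, k₁, k, l, W, hk₀, hk₁, hk, hl, hJ, hf⟩ | ⟨k₀, k₁, l, W, hk₀, hk₁, hl, hJ, hf⟩ |
    ⟨k₀, k, hk₀, hk, hJ, hf⟩ | ⟨k₀, hk₀, hf⟩
  · have h0 : (k₀ : ℂ) ≠ 0 := by exact_mod_cast hk₀
    have h1 : I * (k₁ : ℂ) ≠ 0 := mul_ne_zero I_ne_zero (by exact_mod_cast hk₁)
    refine wedge3_tfae hU he (isClock_zB k) (isRatioAffine_cpow h0 h1 (n1 k₁) (n2 k₁) hl)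
      (fun u hu => hasDerivAt_inv_sq hu) (fun u hu => inv_sq_ne_zero hu) hg hJ ?_ ?_
    -- With `n = i k₁` and `a = 1/(n - 2)`, the coefficient `c` is `(2 - k k₁) / (u (n - 2))`. The
    -- condition `k k₁ ≠ 2` therefore says that `μ` does not vanish.
    · intro u hu h
      have hu0 : (u : ℂ) ≠ 0 := by exact_mod_cast (ne_of_gt hu)
      have := n2 k₁
      field_simp at h
      have h' : (k * k₁ : ℂ) = 2 := by
        linear_combination h + (k * k₁ : ℂ) * I_sq
      exact hk (by exact_mod_cast h')
    · intro p hp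
      rw [hf p hp, zB]
      ring
  · have h0 : (k₀ : ℂ) ≠ 0 := by exact_mod_cast hk₀
    have h1 : I * (k₁ : ℂ) ≠ 0 := mul_ne_zero I_ne_zero (by exact_mod_cast hk₁)
    have R := isRatioAffine_cpow h0 h1 (n1 k₁) (n2 k₁) hl
    -- For the pure rotation `ρ = 0`, so the constant prefactor 1 satisfies the equation of weight
    -- 2.
    refine wedge3_tfae hU he isClock_zC R (s := fun _ => 1)
      (fun u _ => by simpa using hasDerivAt_const u (1 : ℂ)) (fun _ _ => one_ne_zero) hg
      (fun p hp => ⟨Set.mem_univ _, hJ p hp⟩) ?_ ?_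
    · intro u _
      rw [mul_zero, zero_add]
      exact mul_ne_zero R.one_add_ne I_ne_zero
    · intro p hp
      rw [hf p hp, zC]
      ring
  · have h0 : (k₀ : ℂ) ≠ 0 := by exact_mod_cast hk₀
    refine wedge3_tfae hU he (isClock_zB k) (isRatioAffine_exp h0)
      (fun u hu => hasDerivAt_inv_sq hu) (fun u hu => inv_sq_ne_zero hu) hg
      (fun p hp => ⟨hJ p hp, Set.mem_univ _⟩) ?_ ?_
    · intro u hu
      simpa using ⟨hk, ne_of_gt hu⟩
    · intro p hp
      rw [hf p hp, zB]
      ring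
  · have h0 : (k₀ : ℂ) ≠ 0 := by exact_mod_cast hk₀
    refine wedge3_tfae hU he isClock_zC (isRatioAffine_exp h0) (s := fun _ => 1)
      (fun u _ => by simpa using hasDerivAt_const u (1 : ℂ)) (fun _ _ => one_ne_zero) hg
      (fun p hp => ⟨Set.mem_univ _, Set.mem_univ _⟩) (by simp) ?_
    intro p hp
    rw [hf p hp, zC]
    ring

/-- The wave still has an affine profile, now with weight `ε = 0`, which the exponential allows
because `a = 0`. Both conditions again amount to `defect = 0`, but the reduction of `defect` to `g'`
is tied to weight 2. -/
theorem IsBE13Unscaled.wedge3_iff_tildeUpsilon {U : Set Event} (hU : IsOpen U) {f : ℂ → ℝ → ℂ}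
    {g : ℝ → ℂ} (hg : ∀ p ∈ U, DifferentiableAt ℝ g p.2.1) {e : Fin 4 → CField}
    (he : IsNormalizedTetrad f U e) (H : IsBE13Unscaled U f g) :
    (∀ p ∈ U, ∀ x y z : Event, wedge3 (alpha f e) (mu f e) (nu f e) p x y z = 0) ↔
      ∀ p ∈ U, tildeUpsilon f e p = 0 := by
  obtain ⟨k₀, k, hk₀, hk, hf⟩ := H
  have h0 : (k₀ : ℂ) ≠ 0 := by exact_mod_cast hk₀
  obtain ⟨f₁, f₂, f₃, f₄, fu, f₁u, w, c, wu, wuu, x, S, -⟩ :=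
    exists_affineProfile hU (f := f) (g := g) (isClock_zB k) (isRatioAffine_exp h0)
      (s := fun _ => 1) (ε := 0) (fun u _ => by simpa using hasDerivAt_const u (1 : ℂ))
      (fun _ _ => one_ne_zero) (by simp) hg (fun p hp => ⟨(hf p hp).1, Set.mem_univ _⟩)
      (fun u hu => by simpa using ⟨hk, ne_of_gt hu⟩)
      (fun p hp => by rw [(hf p hp).2, zB]; ring)
  exact forall₂_congr fun p hp =>
    (S.wedge3_iff hU he hp).trans (S.tildeUpsilon_iff hU he hp).symm

end PPWave

end
theorem proposition6p9 (U : Set PPWave.Event) (hU : IsOpen U) (f : ℂ → ℝ → ℂ) (g : ℝ → ℂ)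
    (hg : ∀ p ∈ U, ContDiffAt ℝ ((⊤ : ℕ∞) : WithTop ℕ∞) g p.2.1)
    (e : Fin 4 → PPWave.CField) (he : PPWave.IsNormalizedTetrad f U e) :
    (PPWave.IsBCPE13 U f g →
      List.TFAE [
        ∀ p ∈ U, ∀ x y z : PPWave.Event,
          PPWave.wedge3 (PPWave.alpha f e) (PPWave.mu f e) (PPWave.nu f e) p x y z = 0,
        ∀ p ∈ U, PPWave.tildeUpsilon f e p = 0,
        ∀ p ∈ U, deriv g p.2.1 = 0]) ∧
    (PPWave.IsBE13Unscaled U f g →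
      ((∀ p ∈ U, ∀ x y z : PPWave.Event,
          PPWave.wedge3 (PPWave.alpha f e) (PPWave.mu f e) (PPWave.nu f e) p x y z = 0) ↔
        ∀ p ∈ U, PPWave.tildeUpsilon f e p = 0)) := by
  have hg' : ∀ p ∈ U, DifferentiableAt ℝ g p.2.1 := fun p hp =>
    (hg p hp).differentiableAt (by simp)
  exact ⟨fun H => H.tfae hU hg' he, fun H => H.wedge3_iff_tildeUpsilon hU hg' he⟩
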